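/- **Conventions.** Coarse maps take nonempty sets as values. For nonempty subsets $A,B$ of a metric space, $d(A,B)=\inf\{d(a,b):a\in A,b\in B\}$. For $D\ge 1$, a $(D,D)$-quasigeodesic in a metric space $M$ is a (not necessarily continuous) map $f:[0,\ell]\to M$, $\ell\ge 0$, with $\frac1D|s-t|-D\le d(f(s),f(t))\le D|s-t|+D$ for all $s,t\in[0,\ell]$; $f$ may also be a coarse map, sending each point to a nonempty set of diameter at most $D$. A coarse map $f:[0,\ell]\to M$ is an *unparameterized $(D,D)$-quasigeodesic* if there are $L\ge 0$ and a strictly increasing $g:[0,L]\to[0,\ell]$ with $g(0)=0$, $g(L)=\ell$, such that $f\circ g$ is a $(D,D)$-quasigeodesic and, for every integer $0\le j\le L$, the set $f\big([g(j),g(\min\{j+1,L\})]\big)$ has diameter at most $D$. A metric space is *$\delta$-hyperbolic* if it is geodesic and each side of every geodesic triangle lies in the $\delta$-neighbourhood of the union of the other two. All neighbourhoods $\mathcal N_r(A)=\{p:d(p,A)\le r\}$ are closed. **Hierarchically hyperbolic spaces.** A hierarchically hyperbolic space $(\mathcal X,\mathfrak S)$ consists of a metric space $\mathcal X$ in which,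 for some $q\geq 1$, any two points are joined by a $(q,q)$-quasigeodesic, an index set $\mathfrak S$, and $\delta$-hyperbolic spaces $\mathcal CW$ ($W\in\mathfrak S$) for some $\delta\ge 0$, with constants $\xi,\kappa_0\ge0$, $K$, $n\in\mathbb N$, $\lambda\ge1$, $E\ge\max\{\xi,\kappa_0\}$, $\alpha$, such that: 1. (Projections) For each $W$ there is $\pi_W:\mathcal X\to 2^{\mathcal CW}$ with nonempty values of diameter at most $\xi$ and $d(\pi_W(x),\pi_W(y))\le K\,d(x,y)+K$; and $\pi_W(\mathcal X)=\bigcup_{x}\pi_W(x)$ is $K$-quasiconvex: every geodesic of $\mathcal CW$ with endpoints in $\pi_W(\mathcal X)$ lies in $\mathcal N_K(\pi_W(\mathcal X))$. 2. (Nesting) $\mathfrak S$ has a partial order $\sqsubseteq$, and is empty or has a unique $\sqsubseteq$-maximal element. For $V\sqsubsetneq W$ there are a nonempty set $\rho^V_W\subseteq\mathcal CW$ of diameter at most $\xi$ and a map $\rho^W_V:\mathcal CW\to2^{\mathcal CV}$ with nonempty values. 3. (Orthogonality) There is a symmetric anti-reflexive relation $\bot$ on $\mathfrak S$; if $V\sqsubseteq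 W$ and $W\bot U$ then $V\bot U$; if $V\bot W$ then $V,W$ are not $\sqsubseteq$-comparable; and if $U\sqsubseteq T$ and some $V\sqsubseteq T$ has $V\bot U$, then there is $W\sqsubsetneq T$ such that every $V\sqsubseteq T$ with $V\bot U$ satisfies $V\sqsubseteq W$. 4. (Transversality and consistency) Write $V\pitchfork W$ if $V,W$ are neither orthogonal nor $\sqsubseteq$-comparable. If $V\pitchfork W$ there are nonempty sets $\rho^V_W\subseteq\mathcal CW$, $\rho^W_V\subseteq\mathcal CV$ of diameter at most $\xi$ with $\min\{d(\pi_W(x),\rho^V_W),d(\pi_V(x),\rho^W_V)\}\le\kappa_0$ for all $x\in\mathcal X$. If $V\sqsubsetneq W$ then $\min\{d(\pi_W(x),\rho^V_W),\operatorname{diam}(\pi_V(x)\cup\rho^W_V(\pi_W(x)))\}\le\kappa_0$ for all $x$. If $U\sqsubseteq V$, then $d(\rho^U_W,\rho^V_W)\le\kappa_0$ whenever $V\sqsubsetneq W$, or $V\pitchfork W$ and $W\not\bot U$. 5. (Finite complexity) Every set of pairwise $\sqsubseteq$-comparable elements has at most $n$ elements. 6. (Large links) For $W\in\mathfrak S$,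 $x,x'\in\mathcal X$, put $N=\lambda d(\pi_W(x),\pi_W(x'))+\lambda$. There are at most $\lfloor N\rfloor$ elements $T_i\sqsubsetneq W$ such that $d(\pi_W(x),\rho^{T_i}_W)\le N$ for each $i$, and each $T\sqsubsetneq W$ satisfies $T\sqsubseteq T_i$ for some $i$ or $d(\pi_T(x),\pi_T(x'))<E$. 7. (Bounded geodesic image) If $V\sqsubsetneq W$ and $\gamma$ is a geodesic segment of $\mathcal CW$, then $\operatorname{diam}(\rho^W_V(\gamma))\le E$ or $\gamma\cap\mathcal N_E(\rho^V_W)\ne\emptyset$. 8. (Partial realization) If $\{V_j\}$ is a family of pairwise orthogonal elements of $\mathfrak S$ and $p_j\in\pi_{V_j}(\mathcal X)$, there is $x\in\mathcal X$ with, for every $j$: $d(\pi_{V_j}(x),p_j)\le\alpha$; $d(\pi_V(x),\rho^{V_j}_V)\le\alpha$ whenever $V_j\sqsubsetneq V$; and $d(\pi_W(x),\rho^{V_j}_W)\le\alpha$ whenever $W\pitchfork V_j$. 9. (Uniqueness) For each $\kappa\ge0$ there is $\theta_u$ such that $d(x,y)\ge\theta_u$ implies $d(\pi_V(x),\pi_V(y))\ge\kappa$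 for some $V\in\mathfrak S$. **Theorem (Existence of Hierarchy Paths).** Let $(\mathcal X,\mathfrak S)$ be a hierarchically hyperbolic space. Then there exists $D_0\ge1$ such that for all $x,y\in\mathcal X$ there are $\ell\ge 0$ and a $(D_0,D_0)$-quasigeodesic $\gamma:[0,\ell]\to\mathcal X$ with $\gamma(0)=x$ and $\gamma(\ell)=y$ such that, for every $W\in\mathfrak S$, the coarse map $\pi_W\circ\gamma:[0,\ell]\to2^{\mathcal CW}$ is an unparameterized $(D_0,D_0)$-quasigeodesic. -/

import Mathlib

open Set

namespace HHS

/-- The set `A` has diameter at most `r`. -/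
def DiamLE {M : Type*} [MetricSpace M] (A : Set M) (r : ℝ) : Prop :=
  ∀ a ∈ A, ∀ b ∈ A, dist a b ≤ r

/-- The (infimal) distance between two subsets; it is only used for nonempty subsets. -/
noncomputable def setDist {M : Type*} [MetricSpace M] (A B : Set M) : ℝ :=
  sInf {r : ℝ | ∃ a ∈ A, ∃ b ∈ B, r = dist a b}

/-- `σ` is (the image of) a geodesic from `p` to `q`. -/
def IsGeodesicSegment {M : Type*} [MetricSpace M] (p q : M) (σ : Set M) : Prop :=
  ∃ (ℓ : ℝ) (c : ℝ → M), 0 ≤ ℓ ∧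
    (∀ s ∈ Icc (0 : ℝ) ℓ, ∀ t ∈ Icc (0 : ℝ) ℓ, dist (c s) (c t) = |s - t|) ∧
    c 0 = p ∧ c ℓ = q ∧ σ = c '' Icc (0 : ℝ) ℓ

/-- `M` is a geodesic metric space all of whose geodesic triangles are `δ`-slim. -/
def IsHyperbolicSpace (M : Type*) [MetricSpace M] (δ : ℝ) : Prop :=
  (∀ p q : M, ∃ σ : Set M, IsGeodesicSegment p q σ) ∧
  ∀ (p q r : M) (σ₁ σ₂ σ₃ : Set M),
    IsGeodesicSegment p q σ₁ → IsGeodesicSegment q r σ₂ → IsGeodesicSegment r p σ₃ →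
    ∀ a ∈ σ₁, ∃ b ∈ σ₂ ∪ σ₃, dist a b ≤ δ

/-- The restriction of `γ` to `[0, ℓ]` is a `(D, D)`-quasigeodesic, i.e. a (not necessarily
continuous) `(D, D)`-quasi-isometric embedding. -/
def IsQuasigeodesic {M : Type*} [MetricSpace M] (D ℓ : ℝ) (γ : ℝ → M) : Prop :=
  ∀ s ∈ Icc (0 : ℝ) ℓ, ∀ t ∈ Icc (0 : ℝ) ℓ,
    D⁻¹ * |s - t| - D ≤ dist (γ s) (γ t) ∧ dist (γ s) (γ t) ≤ D * |s - t| + D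

/-- The version of `IsQuasigeodesic` for coarse maps, which send points to nonempty sets of
diameter at most `D`. -/
def IsCoarseQuasigeodesic {M : Type*} [MetricSpace M] (D ℓ : ℝ) (f : ℝ → Set M) : Prop :=
  (∀ s ∈ Icc (0 : ℝ) ℓ, (f s).Nonempty ∧ DiamLE (f s) D) ∧
  ∀ s ∈ Icc (0 : ℝ) ℓ, ∀ t ∈ Icc (0 : ℝ) ℓ,
    D⁻¹ * |s - t| - D ≤ setDist (f s) (f t) ∧ setDist (f s) (f t) ≤ D * |s - t| + D

/-- The coarse map `f` on `[0, ℓ]` is an unparameterized `(D, D)`-quasigeodesic: some strictly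
increasing `g : [0, L] → [0, ℓ]` with `g 0 = 0` and `g L = ℓ` makes `f ∘ g` a
`(D, D)`-quasigeodesic, and between the consecutive parameters `g j` and `g (j + 1)`
(or `g j` and `g L` if `j + 1 > L`) the map `f` only moves in a set of diameter at most `D`. -/
def IsUnparamQuasigeodesic {M : Type*} [MetricSpace M] (D ℓ : ℝ) (f : ℝ → Set M) : Prop :=
  ∃ (L : ℝ) (g : ℝ → ℝ), 0 ≤ L ∧
    StrictMonoOn g (Icc 0 L) ∧ MapsTo g (Icc 0 L) (Icc 0 ℓ) ∧ g 0 = 0 ∧ g L = ℓ ∧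
    IsCoarseQuasigeodesic D L (fun t => f (g t)) ∧
    ∀ j : ℕ, (j : ℝ) ≤ L →
      DiamLE (⋃ t ∈ Icc (g (j : ℝ)) (g (min ((j : ℝ) + 1) L)), f t) D

/-- `M` is a `q`-quasigeodesic space: any two points are joined by a `(q, q)`-quasigeodesic. -/
def IsQuasigeodesicSpace (M : Type*) [MetricSpace M] (q : ℝ) : Prop :=
  ∀ x y : M, ∃ (ℓ : ℝ) (γ : ℝ → M), 0 ≤ ℓ ∧ γ 0 = x ∧ γ ℓ = y ∧ IsQuasigeodesic q ℓ γ

/-- Two indices are transverse if they are not orthogonal and neither is nested in the other. -/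
def Transverse {S : Type*} [PartialOrder S] (orth : S → S → Prop) (V W : S) : Prop :=
  ¬ orth V W ∧ ¬ V ≤ W ∧ ¬ W ≤ V

/-- A hierarchically hyperbolic structure on the metric space `X`, with index set `S` and
associated spaces `C W`, `W ∈ S`. The order `V ≤ W` on `S` is nesting, `orth` is orthogonality.
The set `rhoSet V W` is the subset `ρ^V_W` of `C W`, meaningful when `V < W` or `V`, `W` are
transverse; `rhoMap W V` is the projection `ρ^W_V` from `C W` to subsets of `C V`, meaningful
when `V < W`. -/
structure HierarchicallyHyperbolic (X : Type*) [MetricSpace X]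
    (S : Type*) [PartialOrder S] (C : S → Type*) [∀ W, MetricSpace (C W)] where
  /-- orthogonality -/
  orth : S → S → Prop
  /-- the projections from `X` to the associated spaces -/
  proj : (W : S) → X → Set (C W)
  rhoSet : (V W : S) → Set (C W)
  rhoMap : (W V : S) → C W → Set (C V)
  -- the constants
  q : ℝ
  δ : ℝ
  ξ : ℝ
  K : ℝ
  κ₀ : ℝ
  n : ℕ
  lam : ℝ
  E : ℝ
  α : ℝ
  one_le_q : 1 ≤ q
  δ_nonneg : 0 ≤ δ
  ξ_nonneg : 0 ≤ ξ
  κ₀_nonneg : 0 ≤ κ₀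
  one_le_lam : 1 ≤ lam
  max_le_E : max ξ κ₀ ≤ E
  quasigeodesic_space : IsQuasigeodesicSpace X q
  hyperbolic : ∀ W, IsHyperbolicSpace (C W) δ
  -- projections
  proj_nonempty : ∀ W x, (proj W x).Nonempty
  proj_diam : ∀ W x, DiamLE (proj W x) ξ
  proj_lipschitz : ∀ W x y, setDist (proj W x) (proj W y) ≤ K * dist x y + K
  /-- the image of each projection is `K`-quasiconvex -/
  proj_quasiconvex : ∀ (W : S) (x y : X), ∀ p ∈ proj W x, ∀ p' ∈ proj W y, ∀ σ : Set (C W),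
    IsGeodesicSegment p p' σ → ∀ a ∈ σ, Metric.infDist a (⋃ z : X, proj W z) ≤ K
  -- nesting
  unique_maximal : IsEmpty S ∨ ∃! M : S, IsMax M
  rhoSet_nested : ∀ V W, V < W → (rhoSet V W).Nonempty ∧ DiamLE (rhoSet V W) ξ
  rhoMap_nonempty : ∀ V W, V < W → ∀ p, (rhoMap W V p).Nonempty
  -- orthogonality
  orth_symm : ∀ V W, orth V W → orth W V
  orth_irrefl : ∀ V, ¬ orth V V
  orth_of_nested : ∀ V W U, V ≤ W → orth W U → orth V U
  orth_container : ∀ T U, U ≤ T → (∃ V, V ≤ T ∧ orth V U) →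
    ∃ W, W < T ∧ ∀ V, orth V U → V ≤ T → V ≤ W
  orth_not_comparable : ∀ V W, orth V W → ¬ V ≤ W ∧ ¬ W ≤ V
  -- transversality and consistency
  rhoSet_transverse : ∀ V W, Transverse orth V W →
    (rhoSet V W).Nonempty ∧ DiamLE (rhoSet V W) ξ
  consistency_transverse : ∀ V W, Transverse orth V W → ∀ x,
    min (setDist (proj W x) (rhoSet V W)) (setDist (proj V x) (rhoSet W V)) ≤ κ₀
  consistency_nested : ∀ V W, V < W → ∀ x,
    setDist (proj W x) (rhoSet V W) ≤ κ₀ ∨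
      DiamLE (proj V x ∪ ⋃ p ∈ proj W x, rhoMap W V p) κ₀
  rho_consistency : ∀ U V W, U ≤ V → (V < W ∨ (Transverse orth V W ∧ ¬ orth W U)) →
    setDist (rhoSet U W) (rhoSet V W) ≤ κ₀
  -- finite complexity
  finite_complexity : ∀ A : Set S, IsChain (· ≤ ·) A → A.encard ≤ n
  -- large links
  large_links : ∀ (W : S) (x x' : X), ∃ T : Finset S,
    T.card ≤ ⌊lam * setDist (proj W x) (proj W x') + lam⌋₊ ∧
    (∀ U ∈ T, U < W) ∧
    (∀ V, V < W → (∃ U ∈ T, V ≤ U) ∨ setDist (proj V x) (proj V x') < E) ∧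
    ∀ U ∈ T, setDist (proj W x) (rhoSet U W) ≤ lam * setDist (proj W x) (proj W x') + lam
  -- bounded geodesic image
  bounded_geodesic_image : ∀ V W, V < W → ∀ (p q : C W) (σ : Set (C W)),
    IsGeodesicSegment p q σ →
    DiamLE (⋃ a ∈ σ, rhoMap W V a) E ∨ ∃ a ∈ σ, Metric.infDist a (rhoSet V W) ≤ E
  -- partial realization
  partial_realization : ∀ (A : Set S), A.Pairwise orth →
    ∀ p : (V : A) → C V, (∀ V : A, ∃ z : X, p V ∈ proj V z) →
    ∃ x : X, ∀ V : A,
      setDist (proj V x) {p V} ≤ α ∧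
      (∀ W, (V : S) < W → setDist (proj W x) (rhoSet V W) ≤ α) ∧
      ∀ W, Transverse orth W V → setDist (proj W x) (rhoSet V W) ≤ α
  -- uniqueness
  uniqueness : ∀ κ : ℝ, 0 ≤ κ → ∃ θ : ℝ, ∀ x y : X, θ ≤ dist x y →
    ∃ V, κ ≤ setDist (proj V x) (proj V y)

/-- The restriction of `γ` to `[0, ℓ]` is a `D`-hierarchy path. -/
def IsHierarchyPath {X : Type*} [MetricSpace X] {S : Type*} [PartialOrder S]
    {C : S → Type*} [∀ W, MetricSpace (C W)] (H : HierarchicallyHyperbolic X S C)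
    (D ℓ : ℝ) (γ : ℝ → X) : Prop :=
  IsQuasigeodesic D ℓ γ ∧
  ∀ W : S, IsUnparamQuasigeodesic D ℓ (fun t => H.proj W (γ t))

end HHS

/-! After choosing one point in every coarse set (`exists_pointModel`), the proof rests on three
facts. A bound (`sum_dist_le`): the sum of the large projection distances of `x` and `y` is at most
linear in `dist x y`. Along a coarse path from `x` to `y`, the domains in which the current point is
far from both ends are pairwise non-transverse, so boundedly many are active at a time. Realization
(`exists_realization`): a consistent tuple is coarsely the tuple of projections of a point. A
partial realization point of an orthogonal family is corrected one domain at a time, and an integer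
potential bounds the number of corrections. Monotone paths (`exists_monotone_path`): project a
coarse path to the geodesic from `x` to `y` in every domain and replace each position by its running
maximum. These tuples are consistent; realizing them gives a path that is coarsely monotone in all
domains at once, with steps bounded by uniqueness. Discarding points until the steps are long makes
this path a quasigeodesic (`exists_length_le`): each long step is seen by some domain, monotonicity
lets the steps seen by one domain add up, and the bound on sums controls their number. -/

namespace HHS

/-! ### Set distances, geodesics and Gromov products. -/

section Basic

variable {M : Type*} [MetricSpace M]

theorem setDist_le_dist {A B : Set M} {a b : M} (ha : a ∈ A) (hb : b ∈ B) :
    setDist A B ≤ dist a b :=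
  csInf_le ⟨0, by rintro _ ⟨a, _, b, _, rfl⟩; exact dist_nonneg⟩ ⟨a, ha, b, hb, rfl⟩

theorem dist_le_setDist {A B : Set M} {u v : ℝ} (hA : DiamLE A u) (hB : DiamLE B v) {a b : M}
    (ha : a ∈ A) (hb : b ∈ B) : dist a b ≤ setDist A B + u + v := by
  have h : dist a b - u - v ≤ setDist A B := by
    refine le_csInf ⟨_, a, ha, b, hb, rfl⟩ ?_
    rintro _ ⟨a', ha', b', hb', rfl⟩
    have h1 := dist_triangle4 a a' b' b
    have h2 := hA a ha a' ha'
    have h3 := hB b' hb' b hb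
    linarith
  linarith

theorem IsGeodesicSegment.dist_add_dist {p q : M} {σ : Set M} (h : IsGeodesicSegment p q σ)
    {a : M} (ha : a ∈ σ) : dist p a + dist a q = dist p q := by
  obtain ⟨ℓ, c, hℓ, hc, rfl, rfl, rfl⟩ := h
  obtain ⟨t, ht, rfl⟩ := ha
  rw [hc 0 ⟨le_rfl, hℓ⟩ t ht, hc t ht ℓ ⟨hℓ, le_rfl⟩, hc 0 ⟨le_rfl, hℓ⟩ ℓ ⟨hℓ, le_rfl⟩,
    abs_of_nonpos (by linarith [ht.1]), abs_of_nonpos (by linarith [ht.2]),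
    abs_of_nonpos (by linarith)]
  ring

theorem IsGeodesicSegment.left_mem {p q : M} {σ : Set M} (h : IsGeodesicSegment p q σ) :
    p ∈ σ := by
  obtain ⟨ℓ, c, hℓ, hc, rfl, rfl, rfl⟩ := h
  exact ⟨0, ⟨le_rfl, hℓ⟩, rfl⟩

theorem IsGeodesicSegment.right_mem {p q : M} {σ : Set M} (h : IsGeodesicSegment p q σ) :
    q ∈ σ := by
  obtain ⟨ℓ, c, hℓ, hc, rfl, rfl, rfl⟩ := h
  exact ⟨ℓ, ⟨hℓ, le_rfl⟩, rfl⟩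

/-- An isometric parameterization of `[0, dist p q]` by a geodesic from `p` to `q`. -/
def IsGeodesicCurve (p q : M) (c : ℝ → M) : Prop :=
  (∀ s ∈ Icc (0 : ℝ) (dist p q), ∀ t ∈ Icc (0 : ℝ) (dist p q), dist (c s) (c t) = |s - t|) ∧
    c 0 = p ∧ c (dist p q) = q

theorem IsGeodesicSegment.exists_curve {p q : M} {σ : Set M} (h : IsGeodesicSegment p q σ) :
    ∃ c : ℝ → M, IsGeodesicCurve p q c := by
  obtain ⟨ℓ, c, hℓ, hc, rfl, rfl, rfl⟩ := h
  have : dist (c 0) (c ℓ) = ℓ := by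
    rw [hc 0 ⟨le_rfl, hℓ⟩ ℓ ⟨hℓ, le_rfl⟩, zero_sub, abs_neg, abs_of_nonneg hℓ]
  exact ⟨c, by rw [this]; exact hc, rfl, by rw [this]⟩

theorem IsGeodesicCurve.segment {p q : M} {c : ℝ → M} (h : IsGeodesicCurve p q c) {s t : ℝ}
    (hs : 0 ≤ s) (hst : s ≤ t) (ht : t ≤ dist p q) :
    IsGeodesicSegment (c s) (c t) (c '' Icc s t) := by
  refine ⟨t - s, fun u => c (s + u), by linarith, ?_, by simp, by simp, ?_⟩
  · intro u hu v hv
    rw [h.1 _ ⟨by linarith [hu.1], by linarith [hu.2]⟩ _ ⟨by linarith [hv.1], by linarith [hv.2]⟩]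
    congr 1; ring
  · ext a
    constructor
    · rintro ⟨u, hu, rfl⟩
      exact ⟨u - s, ⟨by linarith [hu.1], by linarith [hu.2]⟩, by simp⟩
    · rintro ⟨u, hu, rfl⟩
      exact ⟨s + u, ⟨by linarith [hu.1], by linarith [hu.2]⟩, rfl⟩

theorem IsGeodesicCurve.dist_left {p q : M} {c : ℝ → M} (h : IsGeodesicCurve p q c) {s : ℝ}
    (hs : 0 ≤ s) (hs' : s ≤ dist p q) : dist p (c s) = s := by
  conv_lhs => rw [← h.2.1]
  rw [h.1 0 ⟨le_rfl, dist_nonneg⟩ s ⟨hs, hs'⟩, zero_sub, abs_neg, abs_of_nonneg hs]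

theorem IsGeodesicCurve.dist_right {p q : M} {c : ℝ → M} (h : IsGeodesicCurve p q c) {s : ℝ}
    (hs : 0 ≤ s) (hs' : s ≤ dist p q) : dist (c s) q = dist p q - s := by
  conv_lhs => rw [← h.2.2]
  rw [h.1 s ⟨hs, hs'⟩ _ ⟨dist_nonneg, le_rfl⟩, abs_of_nonpos (by linarith)]; ring

/-- The Gromov product of `z` and `y` based at `x`. It is used as a coarse projection of `z` to
a geodesic from `x` to `y`. -/
noncomputable def gprod (x y z : M) : ℝ := (dist x z + dist x y - dist z y) / 2

theorem gprod_nonneg (x y z : M) : 0 ≤ gprod x y z := by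
  have := dist_triangle z x y
  rw [dist_comm z x] at this
  unfold gprod; linarith

theorem gprod_le (x y z : M) : gprod x y z ≤ dist x y := by
  have := dist_triangle x y z
  rw [dist_comm y z] at this
  unfold gprod; linarith

theorem gprod_le_dist (x y z : M) : gprod x y z ≤ dist x z := by
  have := dist_triangle x z y
  unfold gprod; linarith

theorem dist_sub_gprod_le (x y z : M) : dist x y - gprod x y z ≤ dist z y := by
  have := dist_triangle x z y
  unfold gprod; linarith

theorem gprod_self_left (x y : M) : gprod x y x = 0 := by simp [gprod]

theorem gprod_self_right (x y : M) : gprod x y y = dist x y := by simp [gprod]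

theorem abs_gprod_sub_le (x y z w : M) : |gprod x y z - gprod x y w| ≤ dist z w := by
  have h1 := dist_triangle x z w
  have h2 := dist_triangle x w z
  have h3 := dist_triangle z w y
  have h4 := dist_triangle w z y
  rw [dist_comm w z] at h2 h4
  unfold gprod
  rw [abs_le]; constructor <;> linarith

theorem IsGeodesicCurve.gprod_eq {p q : M} {c : ℝ → M} (h : IsGeodesicCurve p q c) {s : ℝ}
    (hs : 0 ≤ s) (hs' : s ≤ dist p q) : gprod p q (c s) = s := by
  rw [gprod, h.dist_left hs hs', h.dist_right hs hs']; ring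

/-- This and the next lemma keep a geodesic ending at `y`, or starting at `x`, on one side of a
given position, hence away from points on the other side. -/
theorem IsGeodesicSegment.gprod_ge {x y z : M} {σ : Set M} (h : IsGeodesicSegment z y σ) {a : M}
    (ha : a ∈ σ) : gprod x y z ≤ gprod x y a := by
  have h1 := h.dist_add_dist ha
  have h2 := dist_triangle x a z
  rw [dist_comm a z] at h2
  unfold gprod; linarith

theorem IsGeodesicSegment.gprod_le {x y z : M} {σ : Set M} (h : IsGeodesicSegment x z σ) {a : M}
    (ha : a ∈ σ) : gprod x y a ≤ gprod x y z := by
  have h1 := h.dist_add_dist ha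
  have h2 := dist_triangle z a y
  rw [dist_comm z a] at h2
  have h3 := dist_triangle a z y
  unfold gprod; linarith

end Basic

/-! ### Choosing points in the coarse sets. -/

theorem Transverse.symm {S : Type*} [PartialOrder S] {orth : S → S → Prop}
    (ho : ∀ V W, orth V W → orth W V) {V W : S} (h : Transverse orth V W) :
    Transverse orth W V :=
  ⟨fun h' => h.1 (ho _ _ h'), h.2.2, h.2.1⟩

/-- The data of a hierarchically hyperbolic structure after a choice of one point in each coarse
image, with a single constant `k`. -/
structure PointModel (X : Type*) [MetricSpace X] (S : Type*) [PartialOrder S]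
    (C : S → Type*) [∀ W, MetricSpace (C W)] where
  orth : S → S → Prop
  P : (W : S) → X → C W
  R : (V W : S) → C W
  F : (W V : S) → C W → C V
  k : ℝ
  n : ℕ
  rk : S → ℕ
  one_le_k : 1 ≤ k
  quasigeodesic_space : IsQuasigeodesicSpace X k
  geodesic : ∀ W (p q : C W), ∃ σ : Set (C W), IsGeodesicSegment p q σ
  lipschitz : ∀ W x y, dist (P W x) (P W y) ≤ k * dist x y + k
  quasiconvex : ∀ W x y σ, IsGeodesicSegment (P W x) (P W y) σ → ∀ a ∈ σ, ∃ z, dist a (P W z) ≤ k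
  orth_symm : ∀ V W, orth V W → orth W V
  orth_irrefl : ∀ V, ¬ orth V V
  orth_of_nested : ∀ V W U, V ≤ W → orth W U → orth V U
  orth_card : ∀ A : Finset S, (A : Set S).Pairwise orth → A.card ≤ n + 1
  rk_lt : ∀ V W, V < W → rk V < rk W
  rk_le : ∀ V, rk V ≤ n
  consistency_transverse : ∀ V W, Transverse orth V W → ∀ x,
    dist (P W x) (R V W) ≤ k ∨ dist (P V x) (R W V) ≤ k
  consistency_nested : ∀ V W, V < W → ∀ x,
    dist (P W x) (R V W) ≤ k ∨ dist (P V x) (F W V (P W x)) ≤ k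
  rho_consistency : ∀ U V W, U ≤ V → Transverse orth V W → Transverse orth U W →
    dist (R U W) (R V W) ≤ k
  bounded_geodesic_image : ∀ V W, V < W → ∀ (p q : C W) (σ : Set (C W)),
    IsGeodesicSegment p q σ → dist (F W V p) (F W V q) ≤ k ∨ ∃ a ∈ σ, dist a (R V W) ≤ k
  partial_realization : ∀ A : Set S, A.Pairwise orth → ∀ z : S → X,
    ∃ x : X, ∀ V ∈ A, dist (P V x) (P V (z V)) ≤ k ∧
      ∀ W, V < W ∨ Transverse orth V W → dist (P W x) (R V W) ≤ k
  uniqueness : ∀ κ : ℝ, ∃ θ : ℝ, ∀ x y : X, θ ≤ dist x y → ∃ V, κ ≤ dist (P V x) (P V y)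

namespace HierarchicallyHyperbolic

variable {X : Type*} [MetricSpace X] {S : Type*} [PartialOrder S]
    {C : S → Type*} [∀ W, MetricSpace (C W)] (H : HierarchicallyHyperbolic X S C)

theorem height_le (V : S) : Order.height V ≤ (H.n : ℕ∞) := by
  refine Order.height_le fun p _ => ?_
  have h1 : IsChain (· ≤ ·) (Set.range p) := by
    rintro _ ⟨i, rfl⟩ _ ⟨j, rfl⟩ _
    rcases le_total i j with h | h
    · exact Or.inl (p.strictMono.monotone h)
    · exact Or.inr (p.strictMono.monotone h)
  have h2 := H.finite_complexity _ h1
  rw [← Set.image_univ, p.strictMono.injective.injOn.encard_image, Set.encard_univ] at h2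
  simp only [ENat.card_eq_coe_fintype_card, Fintype.card_fin] at h2
  have h3 : p.length + 1 ≤ H.n := by exact_mod_cast h2
  exact_mod_cast (by omega : p.length ≤ H.n)

/-- The length of a longest chain below `V`. -/
noncomputable def rank (_ : HierarchicallyHyperbolic X S C) (V : S) : ℕ := (Order.height V).toNat

theorem coe_rank (V : S) : (H.rank V : ℕ∞) = Order.height V :=
  ENat.natCast_toNat (ne_top_of_le_ne_top (ENat.natCast_ne_top _) (H.height_le V))

theorem rank_le (V : S) : H.rank V ≤ H.n := by
  have := H.height_le V
  rw [← H.coe_rank] at this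
  exact_mod_cast this

theorem rank_lt {V W : S} (h : V < W) : H.rank V < H.rank W := by
  have := Order.height_strictMono h (by rw [← H.coe_rank]; exact ENat.natCast_lt_top _)
  rw [← H.coe_rank, ← H.coe_rank] at this
  exact_mod_cast this

/-- All elements other than `a` are orthogonal to `a`, so the container axiom puts them below one
domain properly nested in `T`: removing an element costs at least one unit of rank. -/
theorem card_le_rank (A : Finset S) : ∀ T : S, (A : Set S).Pairwise H.orth → (∀ V ∈ A, V ≤ T) →
    A.card ≤ H.rank T + 1 := by
  classical
  induction A using Finset.induction_on with
  | empty => intro T _ _; simp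
  | insert a A ha ih =>
    intro T hA hT
    rw [Finset.card_insert_of_notMem ha]
    rcases A.eq_empty_or_nonempty with rfl | ⟨v, hv⟩
    · simp
    · have ho : ∀ V ∈ A, H.orth V a := fun V hV =>
        hA (by simp [hV]) (by simp) (by rintro rfl; exact ha hV)
      obtain ⟨W, hW, hW'⟩ := H.orth_container T a (hT a (by simp))
        ⟨v, hT v (by simp [hv]), ho v hv⟩
      have h1 := ih W (hA.mono (by simp)) fun V hV => hW' V (ho V hV) (hT V (by simp [hV]))
      have h2 := H.rank_lt hW
      omega

theorem card_le_of_pairwise_orth (A : Finset S) (hA : (A : Set S).Pairwise H.orth) :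
    A.card ≤ H.n + 1 := by
  rcases H.unique_maximal with h | ⟨M, hM, hM'⟩
  · simp [Finset.eq_empty_of_isEmpty]
  -- The unique maximal element is a top element: an element of largest rank above `V` is maximal,
  -- hence equal to `M`.
  · have hle : ∀ V, V ≤ M := by
      intro V
      have hne : ((fun W => H.rank W) '' Set.Ici V).Nonempty := ⟨_, V, le_rfl, rfl⟩
      have hb : BddAbove ((fun W => H.rank W) '' Set.Ici V) :=
        ⟨H.n, by rintro _ ⟨W, _, rfl⟩; exact H.rank_le W⟩
      obtain ⟨W, hW, hW'⟩ := Nat.sSup_mem hne hb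
      have hmax : IsMax W := by
        intro U hU
        by_contra hlt
        have h1 := H.rank_lt (lt_of_le_not_ge hU hlt)
        have h2 : H.rank U ≤ _ := le_csSup hb ⟨U, le_trans hW hU, rfl⟩
        simp only at hW'
        omega
      rw [← hM' W hmax]
      exact hW
    exact (H.card_le_rank A M hA fun V _ => hle V).trans (by have := H.rank_le M; omega)

/-- A chosen point of the projection of `x` to `C W`. -/
noncomputable def pt (W : S) (x : X) : C W := (H.proj_nonempty W x).some

theorem pt_mem (W : S) (x : X) : H.pt W x ∈ H.proj W x := (H.proj_nonempty W x).some_mem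

theorem exists_pointModel : ∃ M : PointModel X S C, ∀ W x, M.P W x ∈ H.proj W x := by
  classical
  -- The empty family yields a point of `X`, which supplies default values where `ρ` is meaningless.
  obtain ⟨x₀, -⟩ := H.partial_realization ∅ (by simp) (fun V => V.2.elim) (fun V => V.2.elim)
  have hne : ∀ W, Nonempty (C W) := fun W => ⟨H.pt W x₀⟩
  let R : (V W : S) → C W := fun V W =>
    if h : (H.rhoSet V W).Nonempty then h.some else H.pt W x₀
  let F : (W V : S) → C W → C V := fun W V p =>
    if h : (H.rhoMap W V p).Nonempty then h.some else H.pt V x₀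
  have hR : ∀ {V W}, (H.rhoSet V W).Nonempty → R V W ∈ H.rhoSet V W := fun {V W} h => by
    simp only [R, dif_pos h]; exact h.some_mem
  have hF : ∀ {V W} p, V < W → F W V p ∈ H.rhoMap W V p := fun {V W} p h => by
    have h' := H.rhoMap_nonempty V W h p
    simp only [F, dif_pos h']; exact h'.some_mem
  have hq := H.one_le_q
  have hξ := H.ξ_nonneg
  have hκ := H.κ₀_nonneg
  have hE : 0 ≤ H.E := hκ.trans ((le_max_right _ _).trans H.max_le_E)
  have hK := abs_nonneg H.K
  have hK' := le_abs_self H.K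
  have hα := abs_nonneg H.α
  have hα' := le_abs_self H.α
  have hsymm : ∀ {V W}, Transverse H.orth V W → Transverse H.orth W V :=
    fun h => h.symm H.orth_symm
  have hRd : ∀ {V W} {p : C W} {A : Set (C W)} {u r : ℝ}, DiamLE A u → p ∈ A →
      (H.rhoSet V W).Nonempty ∧ DiamLE (H.rhoSet V W) H.ξ → setDist A (H.rhoSet V W) ≤ r →
      dist p (R V W) ≤ r + u + H.ξ := fun hA hp h hr => by
    have := dist_le_setDist hA h.2 hp (hR h.1)
    linarith
  refine ⟨{
    orth := H.orth
    P := H.pt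
    R := R
    F := F
    -- The multiple of `ξ` pays for the choices of points, the summand 1 for replacing an infimum
    -- distance by an actual point.
    k := 1 + H.q + |H.K| + H.κ₀ + H.E + |H.α| + 4 * H.ξ
    n := H.n
    rk := H.rank
    one_le_k := by linarith
    quasigeodesic_space := ?_
    geodesic := fun W => (H.hyperbolic W).1
    lipschitz := ?_
    quasiconvex := ?_
    orth_symm := H.orth_symm
    orth_irrefl := H.orth_irrefl
    orth_of_nested := H.orth_of_nested
    orth_card := H.card_le_of_pairwise_orth
    rk_lt := fun V W h => H.rank_lt h
    rk_le := H.rank_le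
    consistency_transverse := ?_
    consistency_nested := ?_
    rho_consistency := ?_
    bounded_geodesic_image := ?_
    partial_realization := ?_
    uniqueness := ?_ }, H.pt_mem⟩
  · intro x y
    obtain ⟨ℓ, γ, hℓ, h0, h1, h2⟩ := H.quasigeodesic_space x y
    refine ⟨ℓ, γ, hℓ, h0, h1, fun s hs t ht => ?_⟩
    obtain ⟨h3, h4⟩ := h2 s hs t ht
    have h5 := abs_nonneg (s - t)
    have hle : H.q ≤ 1 + H.q + |H.K| + H.κ₀ + H.E + |H.α| + 4 * H.ξ := by linarith
    have h6 := mul_le_mul_of_nonneg_right (inv_anti₀ (by linarith) hle) h5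
    have h7 := mul_le_mul_of_nonneg_right hle h5
    constructor <;> linarith
  · intro W x y
    have h1 := dist_le_setDist (H.proj_diam W x) (H.proj_diam W y) (H.pt_mem W x) (H.pt_mem W y)
    have h2 := H.proj_lipschitz W x y
    have h3 : H.K * dist x y ≤ (1 + H.q + |H.K| + H.κ₀ + H.E + |H.α| + 4 * H.ξ) * dist x y :=
      mul_le_mul_of_nonneg_right (by linarith) dist_nonneg
    linarith
  · intro W x y σ hσ a ha
    have h1 := H.proj_quasiconvex W x y _ (H.pt_mem W x) _ (H.pt_mem W y) σ hσ a ha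
    obtain ⟨b, hb, hab⟩ := (Metric.infDist_lt_iff (r := H.K + 1)
      ⟨_, mem_iUnion.2 ⟨x, H.pt_mem W x⟩⟩).1 (h1.trans_lt (lt_add_one _))
    obtain ⟨z, hz⟩ := mem_iUnion.1 hb
    have h2 := H.proj_diam W z b hz _ (H.pt_mem W z)
    have h3 := dist_triangle a b (H.pt W z)
    exact ⟨z, by linarith⟩
  · intro V W h x
    rcases min_le_iff.1 (H.consistency_transverse V W h x) with h1 | h1
    · have := hRd (H.proj_diam W x) (H.pt_mem W x) (H.rhoSet_transverse V W h) h1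
      exact Or.inl (by linarith)
    · have := hRd (H.proj_diam V x) (H.pt_mem V x) (H.rhoSet_transverse W V (hsymm h)) h1
      exact Or.inr (by linarith)
  · intro V W h x
    rcases H.consistency_nested V W h x with h1 | h1
    · have := hRd (H.proj_diam W x) (H.pt_mem W x) (H.rhoSet_nested V W h) h1
      exact Or.inl (by linarith)
    · have := h1 _ (Or.inl (H.pt_mem V x)) _
        (Or.inr (mem_biUnion (H.pt_mem W x) (hF (H.pt W x) h)))
      exact Or.inr (by linarith)
  · intro U V W hUV hVW hUW
    have h1 := H.rho_consistency U V W hUV (Or.inr ⟨hVW, fun h => hUW.1 (H.orth_symm _ _ h)⟩)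
    have h2 := H.rhoSet_transverse U W hUW
    have := hRd h2.2 (hR h2.1) (H.rhoSet_transverse V W hVW) h1
    linarith
  · intro V W h p q σ hσ
    have h0 := H.rhoSet_nested V W h
    rcases H.bounded_geodesic_image V W h p q σ hσ with h1 | ⟨a, ha, h1⟩
    · have := h1 _ (mem_biUnion hσ.left_mem (hF p h)) _ (mem_biUnion hσ.right_mem (hF q h))
      exact Or.inl (by linarith)
    · obtain ⟨b, hb, hab⟩ := (Metric.infDist_lt_iff (r := H.E + 1) h0.1).1
        (h1.trans_lt (lt_add_one _))
      have h2 := h0.2 b hb _ (hR h0.1)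
      have h3 := dist_triangle a b (R V W)
      exact Or.inr ⟨a, ha, by linarith⟩
  · intro A hA z
    obtain ⟨x, hx⟩ := H.partial_realization A hA (fun V => H.pt V (z V))
      (fun V => ⟨z V, H.pt_mem V _⟩)
    refine ⟨x, fun V hV => ?_⟩
    obtain ⟨h1, h2, h3⟩ := hx ⟨V, hV⟩
    constructor
    · have h4 : DiamLE {H.pt V (z V)} 0 := by
        rintro a rfl b rfl; simp
      have := dist_le_setDist (H.proj_diam V x) h4 (H.pt_mem V x) rfl
      simp only at h1
      linarith
    · rintro W (h | h)
      · have := hRd (H.proj_diam W x) (H.pt_mem W x) (H.rhoSet_nested V W h) (h2 W h)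
        linarith
      · have := hRd (H.proj_diam W x) (H.pt_mem W x) (H.rhoSet_transverse V W h)
          (h3 W (hsymm h))
        linarith
  · intro κ
    obtain ⟨θ, hθ⟩ := H.uniqueness (max κ 0) (le_max_right _ _)
    refine ⟨θ, fun x y hxy => ?_⟩
    obtain ⟨V, hV⟩ := hθ x y hxy
    exact ⟨V, (le_max_left _ _).trans (hV.trans (setDist_le_dist (H.pt_mem V x) (H.pt_mem V y)))⟩

end HierarchicallyHyperbolic

/-! ### The linear bound on sums of large projection distances. -/

/-- Clamp `f` to `[a, b]` and telescope. A step raises the clamped value by at most `J`, and cannot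
raise it at all when it starts outside `(a - J, b + J)`. -/
theorem sub_le_mul_card_filter (f : ℕ → ℝ) {J a b : ℝ} {m : ℕ} (hJ : ∀ i, |f (i + 1) - f i| ≤ J)
    (h0 : f 0 ≤ a) (hm : b ≤ f m) :
    b - a ≤ J * ((Finset.range m).filter fun i => a - J < f i ∧ f i < b + J).card := by
  have hJ0 : 0 ≤ J := (abs_nonneg _).trans (hJ 0)
  have h1 : b - a ≤ max a (min b (f m)) - max a (min b (f 0)) := by
    have h2 : max a (min b (f 0)) = a := max_eq_left ((min_le_right _ _).trans h0)
    have h3 : b ≤ max a (min b (f m)) := by rw [min_eq_left hm]; exact le_max_right _ _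
    linarith
  refine h1.trans ?_
  rw [← Finset.sum_range_sub (fun i => max a (min b (f i))), Finset.card_filter, Nat.cast_sum,
    Finset.mul_sum]
  refine Finset.sum_le_sum fun i _ => ?_
  have h4 := abs_le.1 (hJ i)
  split_ifs with h
  · have h5 : max a (min b (f (i + 1))) ≤ max a (min b (f i)) + J := by
      refine max_le (by linarith [le_max_left a (min b (f i))]) ?_
      refine le_trans ?_ (add_le_add_left (le_max_right a _) J)
      rw [← min_add_add_right]
      exact min_le_min (by linarith) (by linarith)
    push_cast; linarith
  · rw [not_and_or, not_lt, not_lt] at h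
    push_cast
    rw [mul_zero, sub_nonpos]
    rcases h with h | h
    · exact (max_le le_rfl ((min_le_right _ _).trans (by linarith))).trans (le_max_left _ _)
    · rw [min_eq_left (by linarith : b ≤ f i)]
      exact max_le_max le_rfl (min_le_left _ _)

namespace PointModel

variable {X : Type*} [MetricSpace X] {S : Type*} [PartialOrder S]
    {C : S → Type*} [∀ W, MetricSpace (C W)] (M : PointModel X S C)

theorem k_nonneg : 0 ≤ M.k := zero_le_one.trans M.one_le_k

/-- Distinct domains of equal rank are not nested, so here they are orthogonal: each of the `n + 1`
ranks contributes at most `n + 1` domains. -/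
theorem card_le_of_not_transverse (A : Finset S)
    (hA : ∀ V ∈ A, ∀ W ∈ A, ¬ Transverse M.orth V W) : A.card ≤ (M.n + 1) * (M.n + 1) := by
  classical
  have h := Finset.card_le_mul_card_image_of_maps_to (s := A) (t := Finset.range (M.n + 1))
    (f := M.rk) (fun V _ => Finset.mem_range.2 (Nat.lt_succ_of_le (M.rk_le V))) (M.n + 1) ?_
  · simpa using h
  · intro r _
    refine M.orth_card _ fun V hV W hW hVW => ?_
    simp only [Finset.coe_filter, mem_ofPred_eq] at hV hW
    by_contra ho
    have h1 := hA V hV.1 W hW.1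
    refine h1 ⟨ho, fun h => ?_, fun h => ?_⟩
    · have := M.rk_lt V W (lt_of_le_of_ne h hVW); omega
    · have := M.rk_lt W V (lt_of_le_of_ne h (Ne.symm hVW)); omega

/-- Any two points are joined by a discrete path with steps of bounded size, whose length is
linearly bounded in their distance. -/
theorem exists_coarse_path (x y : X) : ∃ (m : ℕ) (z : ℕ → X), z 0 = x ∧ z m = y ∧
    (∀ i, dist (z i) (z (i + 1)) ≤ 2 * M.k) ∧ (m : ℝ) ≤ M.k * dist x y + M.k * M.k + 1 := by
  obtain ⟨ℓ, γ, hℓ, h0, h1, h2⟩ := M.quasigeodesic_space x y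
  have hk := M.one_le_k
  have hmem : ∀ i : ℕ, min (i : ℝ) ℓ ∈ Icc 0 ℓ := fun i =>
    ⟨le_min (Nat.cast_nonneg _) hℓ, min_le_right _ _⟩
  refine ⟨⌈ℓ⌉₊, fun i => γ (min i ℓ), by simpa [hℓ] using h0, ?_, fun i => ?_, ?_⟩
  · simpa [min_eq_right (Nat.le_ceil ℓ)] using h1
  · refine (h2 _ (hmem i) _ (hmem (i + 1))).2.trans ?_
    have : |min (i : ℝ) ℓ - min ((i + 1 : ℕ) : ℝ) ℓ| ≤ 1 := by
      have := abs_min_sub_min_le_max (i : ℝ) ℓ ((i + 1 : ℕ) : ℝ) ℓ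
      simpa using this
    nlinarith
  · have h3 := (h2 0 ⟨le_rfl, hℓ⟩ ℓ ⟨hℓ, le_rfl⟩).1
    rw [h0, h1, zero_sub, abs_neg, abs_of_nonneg hℓ] at h3
    have h4 := Nat.ceil_lt_add_one hℓ
    have h5 : ℓ = M.k * (M.k⁻¹ * ℓ) := by field_simp
    have h6 : M.k * (M.k⁻¹ * ℓ) ≤ M.k * (dist x y + M.k) :=
      mul_le_mul_of_nonneg_left (by linarith) (by linarith)
    linarith

theorem dist_P_le {x y : X} {r : ℝ} (h : dist x y ≤ r) (W : S) :
    dist (M.P W x) (M.P W y) ≤ M.k * r + M.k :=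
  (M.lipschitz W x y).trans (by have := mul_le_mul_of_nonneg_left h M.k_nonneg; linarith)

/-- If two domains see three points pairwise far apart, they are not transverse. -/
theorem not_transverse_of_three_far {V W : S} {x y z : X}
    (hV : 2 * M.k < dist (M.P V x) (M.P V y) ∧ 2 * M.k < dist (M.P V x) (M.P V z) ∧
      2 * M.k < dist (M.P V z) (M.P V y))
    (hW : 2 * M.k < dist (M.P W x) (M.P W y) ∧ 2 * M.k < dist (M.P W x) (M.P W z) ∧
      2 * M.k < dist (M.P W z) (M.P W y)) : ¬ Transverse M.orth V W := by
  intro h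
  have key : ∀ {U : S} {r : C U} {p q : X}, dist (M.P U p) r ≤ M.k → dist (M.P U q) r ≤ M.k →
      2 * M.k < dist (M.P U p) (M.P U q) → False := fun {U r p q} h1 h2 h3 => by
    have := dist_triangle_right (M.P U p) (M.P U q) r
    linarith
  obtain ⟨a1, a2, a3⟩ := hV
  obtain ⟨b1, b2, b3⟩ := hW
  -- Pigeonhole: two of the three points are near the same `ρ` point in the same domain.
  rcases M.consistency_transverse V W h x with hx | hx <;>
  rcases M.consistency_transverse V W h y with hy | hy <;>
  rcases M.consistency_transverse V W h z with hz | hz <;>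
  first
  | exact key hx hy ‹_›
  | exact key hx hz ‹_›
  | exact key hz hy ‹_›

/-- The sum of the large projection distances is linearly bounded by the distance. -/
theorem sum_dist_le : ∃ T Q : ℝ, 1 ≤ T ∧ 1 ≤ Q ∧ ∀ (x y : X) (A : Finset S),
    (∀ W ∈ A, T ≤ dist (M.P W x) (M.P W y)) →
    ∑ W ∈ A, dist (M.P W x) (M.P W y) ≤ Q * dist x y + Q := by
  classical
  have hk := M.one_le_k
  set J := M.k * (2 * M.k) + M.k with hJ
  have hJ1 : 1 ≤ J := by nlinarith
  set N : ℕ := (M.n + 1) * (M.n + 1) with hN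
  have hN1 : (1 : ℝ) ≤ N := by
    have : 1 ≤ N := Nat.mul_pos (Nat.succ_pos _) (Nat.succ_pos _)
    exact_mod_cast this
  have hJN : 1 ≤ 2 * J * N := by nlinarith
  -- Margins `2 * M.k + J` are cut off at both ends; above this threshold at least half of the
  -- distance remains.
  refine ⟨8 * M.k + 4 * J, 2 * J * N * (M.k * M.k + M.k + 1), by linarith,
    one_le_mul_of_one_le_of_one_le hJN (by nlinarith), ?_⟩
  intro x y A hA
  obtain ⟨m, z, h0, hm, hz, hlen⟩ := M.exists_coarse_path x y
  have hstep : ∀ W i, dist (M.P W (z i)) (M.P W (z (i + 1))) ≤ J := fun W i =>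
    M.dist_P_le (hz i) W
  -- The pairs `(W, i)` with `act W i` are counted twice: each `W` has many active times (`h1`),
  -- each time few active domains (`h2`).
  let act : S → ℕ → Prop := fun W i =>
    2 * M.k < dist (M.P W x) (M.P W (z i)) ∧ 2 * M.k < dist (M.P W (z i)) (M.P W y)
  have h1 : ∀ W ∈ A, dist (M.P W x) (M.P W y) ≤
      2 * J * ((Finset.range m).filter fun i => act W i).card := by
    intro W hW
    have h2 := sub_le_mul_card_filter (fun i => dist (M.P W x) (M.P W (z i))) (J := J)
      (a := 2 * M.k + J) (b := dist (M.P W x) (M.P W y) - 2 * M.k - J) (m := m)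
      (fun i => ?_) (by simp only [h0, dist_self]; linarith) (by simp only [hm]; linarith)
    · have h3 : ((Finset.range m).filter fun i => 2 * M.k + J - J < dist (M.P W x) (M.P W (z i)) ∧
          dist (M.P W x) (M.P W (z i)) < dist (M.P W x) (M.P W y) - 2 * M.k - J + J) ⊆
          (Finset.range m).filter fun i => act W i := by
        refine Finset.monotone_filter_right _ fun i _ hi => ?_
        have := dist_triangle (M.P W x) (M.P W (z i)) (M.P W y)
        exact ⟨by linarith [hi.1], by linarith [hi.2]⟩
      have h4 : (_ : ℝ) ≤ _ := Nat.cast_le.2 (Finset.card_le_card h3)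
      have h5 := mul_le_mul_of_nonneg_left h4 (by linarith : 0 ≤ J)
      have h6 := hA W hW
      linarith
    · rw [dist_comm _ (M.P W (z (i + 1))), dist_comm _ (M.P W (z i))]
      refine (abs_dist_sub_le _ _ _).trans ?_
      rw [dist_comm]
      exact hstep W i
  have h2 : ∀ i, (A.filter fun W => act W i).card ≤ N := by
    intro i
    refine M.card_le_of_not_transverse _ fun V hV W hW => ?_
    rw [Finset.mem_filter] at hV hW
  
    refine M.not_transverse_of_three_far (x := x) (y := y) (z := z i) ⟨?_, hV.2⟩ ⟨?_, hW.2⟩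
    · have := hA V hV.1; linarith
    · have := hA W hW.1; linarith
  calc ∑ W ∈ A, dist (M.P W x) (M.P W y)
      ≤ ∑ W ∈ A, 2 * J * ((Finset.range m).filter fun i => act W i).card := Finset.sum_le_sum h1
    _ = 2 * J * ((∑ W ∈ A, ((Finset.range m).filter fun i => act W i).card : ℕ) : ℝ) := by
      rw [← Finset.mul_sum]; push_cast; rfl
    _ = 2 * J * ((∑ i ∈ Finset.range m, (A.filter fun W => act W i).card : ℕ) : ℝ) := by
      congr 2
      exact Finset.sum_card_bipartiteAbove_eq_sum_card_bipartiteBelow act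
    _ ≤ 2 * J * ((m * N : ℕ) : ℝ) := by
      refine mul_le_mul_of_nonneg_left (Nat.cast_le.2 ?_) (by linarith)
      simpa using Finset.sum_le_card_nsmul (Finset.range m) _ N fun i _ => h2 i
    _ = 2 * J * N * m := by push_cast; ring
    _ ≤ 2 * J * N * (M.k * dist x y + M.k * M.k + 1) :=
      mul_le_mul_of_nonneg_left hlen (by linarith)
    _ ≤ 2 * J * N * ((M.k * M.k + M.k + 1) * dist x y + (M.k * M.k + M.k + 1)) := by
      refine mul_le_mul_of_nonneg_left ?_ (by linarith)
      have : (0 : ℝ) ≤ dist x y := dist_nonneg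
      nlinarith [mul_nonneg this (mul_self_nonneg M.k)]
    _ = _ := by ring

/-- Each term of the bounded sums is at least 1. Finiteness is what later provides maximal domains
of disagreement. -/
theorem finite_setOf_le_dist : ∃ T : ℝ, ∀ x y : X,
    {W : S | T ≤ dist (M.P W x) (M.P W y)}.Finite := by
  obtain ⟨T, Q, hT, -, h⟩ := M.sum_dist_le
  refine ⟨T, fun x y => ?_⟩
  by_contra hinf
  obtain ⟨A, hA, hcard⟩ := Set.Infinite.exists_subset_card_eq hinf (⌊Q * dist x y + Q⌋₊ + 1)
  have h1 := h x y A fun W hW => hA hW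
  have h2 : (A.card : ℝ) ≤ ∑ W ∈ A, dist (M.P W x) (M.P W y) := by
    simpa using Finset.card_nsmul_le_sum A (fun W => dist (M.P W x) (M.P W y)) 1
      fun W hW => hT.trans (hA hW)
  have h3 := Nat.lt_floor_add_one (Q * dist x y + Q)
  rw [hcard] at h2
  push_cast at h2
  linarith

end PointModel

/-! ### Realization of consistent tuples. -/

namespace PointModel

variable {X : Type*} [MetricSpace X] {S : Type*} [PartialOrder S]
    {C : S → Type*} [∀ W, MetricSpace (C W)] (M : PointModel X S C)

/-- A consistent tuple of points, one in each associated space, lying near the images of the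
projections and coarsely between the projections of two points of `X`. -/
structure Consistent (κ : ℝ) (b : (W : S) → C W) : Prop where
  transverse : ∀ V W, Transverse M.orth V W →
    dist (b W) (M.R V W) ≤ κ ∨ dist (b V) (M.R W V) ≤ κ
  nested : ∀ V W, V < W → dist (b W) (M.R V W) ≤ κ ∨ dist (b V) (M.F W V (b W)) ≤ κ
  near : ∀ W, ∃ z, dist (b W) (M.P W z) ≤ κ
  between : ∃ x y, ∀ W, dist (M.P W x) (b W) ≤ dist (M.P W x) (M.P W y)

variable {M}

/-- For transverse domains in which a point of `X` disagrees with the tuple `b`, the order in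
which they have to be corrected. -/
def Prec (M : PointModel X S C) (κ : ℝ) (b : (W : S) → C W) (V W : S) : Prop :=
  Transverse M.orth V W ∧ dist (b V) (M.R W V) ≤ κ

section Prec

variable {κ : ℝ} {b : (W : S) → C W} {z : X}

/-- In `V`, the tuple is near `R W V` and `z` is far from the tuple, so consistency of `z` must hold
on the side of `W`. -/
theorem Prec.dist_le {V W : S} (h : M.Prec κ b V W) (hk : M.k ≤ κ)
    (hV : 4 * κ < dist (M.P V z) (b V)) : dist (M.P W z) (M.R V W) ≤ M.k := by
  rcases M.consistency_transverse V W h.1 z with h1 | h1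
  · exact h1
  · have := dist_triangle_right (M.P V z) (b V) (M.R W V)
    have h2 := h.2
    have h3 := M.one_le_k
    linarith

theorem Prec.asymm {V W : S} (h : M.Prec κ b V W) (hk : M.k ≤ κ)
    (hV : 4 * κ < dist (M.P V z) (b V)) (hW : 4 * κ < dist (M.P W z) (b W)) :
    ¬ M.Prec κ b W V := fun h' => by
  have h1 := h.dist_le hk hV
  have h2 := dist_triangle_right (M.P W z) (b W) (M.R V W)
  have h3 := M.one_le_k
  have h4 := h'.2
  linarith

theorem Consistent.prec_or_prec (hb : M.Consistent κ b) {V W : S}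
    (h : Transverse M.orth V W) : M.Prec κ b V W ∨ M.Prec κ b W V :=
  (hb.transverse V W h).symm.imp (fun h' => ⟨h, h'⟩) (fun h' => ⟨h.symm M.orth_symm, h'⟩)

/-- In `W`, `z` is near `R V W` and `b W` is near `R U W`, so these two points are far apart
(`hfar`). A partial realization of `{V, U}` would be near both, so `V` and `U` are transverse. If
`U` preceded `V`, a partial realization of `V` alone would violate consistency for `W` and `U`. -/
theorem Consistent.prec_trans (hb : M.Consistent κ b) (hk : M.k ≤ κ) {V W U : S}
    (hV : 4 * κ < dist (M.P V z) (b V)) (hW : 4 * κ < dist (M.P W z) (b W))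
    (hU : 4 * κ < dist (M.P U z) (b U)) (hVU : V ≤ U → V = U) (hUV : U ≤ V → U = V)
    (h₁ : M.Prec κ b V W) (h₂ : M.Prec κ b W U) : M.Prec κ b V U := by
  have hk1 := M.one_le_k
  have hne : V ≠ U := by
    rintro rfl
    exact h₁.asymm hk hV hW h₂
  have hfar : ∀ w : X, dist (M.P W w) (M.R V W) ≤ M.k → dist (M.P W w) (M.R U W) ≤ M.k →
      False := fun w h3 h4 => by
    have h5 := h₁.dist_le hk hV
    have h6 := h₂.2
    have h8 := dist_triangle_right (M.P W z) (M.P W w) (M.R V W)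
    have h9 := dist_triangle_right (M.P W w) (b W) (M.R U W)
    have h10 := dist_triangle (M.P W z) (M.P W w) (b W)
    linarith
  have ho : ¬ M.orth V U := by
    intro ho
    obtain ⟨w, hw⟩ := M.partial_realization {V, U}
      (Set.pairwise_pair.2 fun _ => ⟨ho, M.orth_symm _ _ ho⟩) fun _ => z
    exact hfar w ((hw V (by simp)).2 W (Or.inr h₁.1))
      ((hw U (by simp)).2 W (Or.inr (h₂.1.symm M.orth_symm)))
  have ht : Transverse M.orth V U := ⟨ho, fun h => hne (hVU h), fun h => hne (hUV h).symm⟩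
  rcases hb.prec_or_prec ht with h | h
  · exact h
  · exfalso
    obtain ⟨w, hw⟩ := M.partial_realization {V} (Set.pairwise_singleton _ _) fun _ => z
    have hw' := (hw V rfl).2
    have h3 := hw' W (Or.inr h₁.1)
    have h4 := hw' U (Or.inr ht)
    rcases M.consistency_transverse W U h₂.1 w with h5 | h5
    · have h6 := h₂.dist_le hk hW
      have h7 := h.2
      have h8 := dist_triangle_right (M.P U z) (M.P U w) (M.R W U)
      have h9 := dist_triangle_right (M.P U w) (b U) (M.R V U)
      have h10 := dist_triangle (M.P U z) (M.P U w) (b U)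
      linarith
    · exact hfar w h3 h5

/-- If a point of `X` is far from a consistent tuple in some domains, then there is such a
domain `W` for which the tuple satisfies all the conditions that partial realization for `W`
imposes on the other domains. -/
theorem Consistent.exists_correctable (hb : M.Consistent κ b) (hk : M.k ≤ κ) {θ : ℝ}
    (hθ : 4 * κ ≤ θ) (hfin : {Y | θ < dist (M.P Y z) (b Y)}.Finite)
    (hne : ∃ Y, θ < dist (M.P Y z) (b Y)) :
    ∃ W, θ < dist (M.P W z) (b W) ∧
      ∀ Y, (W < Y ∨ Transverse M.orth W Y) → dist (b Y) (M.R W Y) ≤ θ + κ := by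
  have hk1 := M.one_le_k
  let B : Set S := {Y | θ < dist (M.P Y z) (b Y)}
  have hle : ∀ Y ∈ B, ∃ Y', Maximal (· ∈ B) Y' ∧ Y ≤ Y' := fun Y hY => by
    obtain ⟨Y', h1, h2⟩ := hfin.exists_le_maximal hY
    exact ⟨Y', h2, h1⟩
  let Bm := {Y // Maximal (· ∈ B) Y}
  have : Finite Bm := (hfin.subset fun Y (hY : Maximal (· ∈ B) Y) => hY.prop).to_subtype
  have hfar : ∀ V : Bm, 4 * κ < dist (M.P V.1 z) (b V.1) := fun V =>
    hθ.trans_lt V.2.prop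
  -- The order is reversed: the minimal element chosen below is last for `Prec` among the maximal
  -- domains of disagreement.
  let r : Bm → Bm → Prop := fun V W => M.Prec κ b W.1 V.1
  have : IsTrans Bm r := ⟨fun V W U h1 h2 => hb.prec_trans hk (hfar U) (hfar W) (hfar V)
    (fun h => U.2.eq_of_le V.2.prop h) (fun h => V.2.eq_of_le U.2.prop h) h2 h1⟩
  have : Std.Irrefl r := ⟨fun V h => h.asymm hk (hfar V) (hfar V) h⟩
  have hwf : WellFounded r := Finite.wellFounded_of_trans_of_irrefl r
  obtain ⟨Y₀, hY₀⟩ := hne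
  obtain ⟨Y₁, hY₁, -⟩ := hle Y₀ hY₀
  obtain ⟨W, -, hW⟩ := hwf.has_min Set.univ ⟨⟨Y₁, hY₁⟩, trivial⟩
  obtain ⟨W, hWmax⟩ := W
  have hWB : θ < dist (M.P W z) (b W) := hWmax.prop
  have htri : ∀ r : C W, dist (M.P W z) r ≤ κ → ¬ dist (b W) r ≤ κ := fun r h1 h2 => by
    have := dist_triangle_right (M.P W z) (b W) r
    linarith
  have hgood : ∀ Y, ¬ θ < dist (M.P Y z) (b Y) → dist (M.P Y z) (M.R W Y) ≤ M.k →
      dist (b Y) (M.R W Y) ≤ θ + κ := fun Y h1 h2 => by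
    have := dist_triangle_left (b Y) (M.R W Y) (M.P Y z)
    linarith
  refine ⟨W, hWB, ?_⟩
  rintro Y (h | h)
  · have hY : ¬ θ < dist (M.P Y z) (b Y) := fun hY => hWmax.not_prop_of_gt h hY
    rcases M.consistency_nested W Y h z with h1 | h1
    · exact hgood Y hY h1
    rcases hb.nested W Y h with h2 | h2
    · linarith
    -- In `Y` the points of `z` and `b` are close, but their images under `F Y W` are far apart, so
    -- a geodesic between them passes near `R W Y`.
    obtain ⟨σ, hσ⟩ := M.geodesic Y (M.P Y z) (b Y)
    rcases M.bounded_geodesic_image W Y h _ _ σ hσ with h3 | ⟨a, ha, h3⟩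
    · have h4 := dist_triangle4 (M.P W z) (M.F Y W (M.P Y z)) (M.F Y W (b Y)) (b W)
      rw [dist_comm (M.F Y W (b Y))] at h4
      linarith
    · have h4 := hσ.dist_add_dist ha
      have h5 : (0 : ℝ) ≤ dist (M.P Y z) a := dist_nonneg
      have h6 := dist_triangle_left (b Y) (M.R W Y) a
      linarith
  -- If `Y` is bad, a maximal bad `Y'` above it precedes `W`. So `z` is near `R Y' W`, hence near `R
  -- Y W`; then `b W` is not, and consistency of `b` applies in `Y`.
  · by_cases hY : θ < dist (M.P Y z) (b Y)
    · obtain ⟨Y', hY'max, hYY'⟩ := hle Y hY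
      have ht : Transverse M.orth Y' W := by
        refine ⟨fun ho => h.1 (M.orth_symm _ _ (M.orth_of_nested _ _ _ hYY' ho)), fun hle => ?_,
          fun hle => ?_⟩
        · exact h.2.2 (hYY'.trans hle)
        · have := hWmax.eq_of_le hY'max.prop hle
          subst this
          exact h.2.2 hYY'
      have hp : M.Prec κ b Y' W := (hb.prec_or_prec ht).resolve_right
        fun h' => hW ⟨Y', hY'max⟩ trivial h'
      have h1 := hp.dist_le hk (hfar ⟨Y', hY'max⟩)
      have h2 := M.rho_consistency Y Y' W hYY' ht (h.symm M.orth_symm)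
      rcases hb.transverse W Y h with h3 | h3
      · linarith
      · have h4 := dist_triangle_right (M.P W z) (b W) (M.R Y W)
        have h5 := dist_triangle_right (M.P W z) (M.R Y W) (M.R Y' W)
        linarith
    · rcases hb.transverse W Y h with h1 | h1
      · linarith
      · rcases M.consistency_transverse W Y h z with h2 | h2
        · exact hgood Y hY h2
        · exact absurd h1 (htri _ (h2.trans hk))

end Prec

/-- The partial realization points of the pairwise orthogonal family `A` for the tuple `b` do
not contradict `b` in any domain containing or transverse to an element of `A`. -/
structure Valid (M : PointModel X S C) (c : ℝ) (b : (W : S) → C W) (A : Finset S) : Prop where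
  pairwise : (A : Set S).Pairwise M.orth
  dist_le : ∀ U ∈ A, ∀ Y, (U < Y ∨ Transverse M.orth U Y) → dist (b Y) (M.R U Y) ≤ c

/-- A quantity that increases when a family is corrected. -/
def potential (M : PointModel X S C) (A : Finset S) : ℕ := ∑ U ∈ A, (M.n + 1 - M.rk U)

theorem Valid.potential_le {c : ℝ} {b : (W : S) → C W} {A : Finset S} (h : M.Valid c b A) :
    M.potential A ≤ (M.n + 1) * (M.n + 1) := by
  have h1 := Finset.sum_le_card_nsmul A (fun U => M.n + 1 - M.rk U) (M.n + 1)
    fun U _ => Nat.sub_le _ _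
  have h2 := Nat.mul_le_mul_right (M.n + 1) (M.orth_card A h.pairwise)
  simp only [smul_eq_mul] at h1
  exact h1.trans h2

/-- If the realization of `A` misses `b`, a correctable domain `W` is added. The realization already
agrees with `b` on `A` and on all domains containing or transverse to an element of `A`, so each `U
∈ A` is orthogonal to `W` or properly contains it. The containing ones are dropped. -/
theorem Valid.realize_or_extend {κ T : ℝ} (hk : M.k ≤ κ)
    (hT : ∀ x y : X, {W : S | T ≤ dist (M.P W x) (M.P W y)}.Finite) (c : ℝ) :
    ∃ θ : ℝ, ∀ (b : (W : S) → C W) (A : Finset S), M.Consistent κ b → M.Valid c b A →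
      (∃ z, ∀ W, dist (M.P W z) (b W) ≤ θ) ∨
        ∃ A', M.Valid θ b A' ∧ M.potential A < M.potential A' := by
  classical
  have hk1 := M.one_le_k
  -- The summands serve, in order, `exists_correctable`, the finiteness `hfin`, and the agreement
  -- enforced by `A` in `hrel`.
  set θ := 4 * κ + 2 * |T| + |c| with hθ
  have hT0 := abs_nonneg T
  have hT1 := le_abs_self T
  have hc0 := abs_nonneg c
  have hc1 := le_abs_self c
  refine ⟨θ + κ, fun b A hb hA => ?_⟩
  choose p hp using hb.near
  obtain ⟨z, hz⟩ := M.partial_realization A hA.pairwise p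
  by_cases hne : ∃ Y, θ < dist (M.P Y z) (b Y)
  swap
  · push Not at hne
    exact Or.inl ⟨z, fun W => (hne W).trans (by linarith)⟩
  right
  have hfin : {Y | θ < dist (M.P Y z) (b Y)}.Finite := by
    obtain ⟨x, y, hxy⟩ := hb.between
    refine ((hT z x).union (hT x y)).subset fun Y hY => ?_
    have h1 := dist_triangle (M.P Y z) (M.P Y x) (b Y)
    have h2 := hxy Y
    by_contra hcon
    simp only [Set.mem_union, Set.mem_ofPred_eq, not_or, not_le] at hcon hY
    linarith [hcon.1, hcon.2]
  obtain ⟨W, hW, hW'⟩ := hb.exists_correctable hk (by linarith) hfin hne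
  have hrel : ∀ U ∈ A, M.orth U W ∨ W < U := by
    intro U hU
    obtain ⟨h1, h2⟩ := hz U hU
    have h3 : ∀ Y, (U < Y ∨ Transverse M.orth U Y) → ¬ θ < dist (M.P Y z) (b Y) := by
      intro Y hY hlt
      have h4 := h2 Y hY
      have h5 := hA.dist_le U hU Y hY
      have h6 := dist_triangle_right (M.P Y z) (b Y) (M.R U Y)
      linarith
    have h4 : U ≠ W := by
      rintro rfl
      have h5 := hp U
      have h6 := dist_triangle_right (M.P U z) (b U) (M.P U (p U))
      linarith
    by_contra hcon
    rw [not_or] at hcon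
    refine h3 W (or_iff_not_imp_left.2 fun h => ⟨hcon.1, fun h' => ?_, fun h' => ?_⟩) hW
    · exact h (lt_of_le_of_ne h' h4)
    · exact hcon.2 (lt_of_le_of_ne h' h4.symm)
  refine ⟨insert W (A.filter fun U => M.orth U W), ⟨?_, ?_⟩, ?_⟩
  · rw [Finset.coe_insert]
    refine Set.pairwise_insert.2 ⟨hA.pairwise.mono fun U hU => (Finset.mem_filter.1 hU).1, ?_⟩
    intro U hU _
    have h := (Finset.mem_filter.1 hU).2
    exact ⟨M.orth_symm _ _ h, h⟩
  · intro U hU Y hY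
    rcases Finset.mem_insert.1 hU with rfl | hU
    · exact hW' Y hY
    · exact (hA.dist_le U (Finset.mem_filter.1 hU).1 Y hY).trans (by linarith)
  · have hWn : W ∉ A.filter fun U => M.orth U W := fun h =>
      M.orth_irrefl W (Finset.mem_filter.1 h).2
    have hWr := M.rk_le W
    rw [potential, potential, Finset.sum_insert hWn,
      ← Finset.sum_filter_add_sum_filter_not A (fun U => M.orth U W), add_comm]
    refine Nat.add_lt_add_right ?_ _
    rcases (A.filter fun U => ¬ M.orth U W).eq_empty_or_nonempty with h | ⟨U, hU⟩
    · rw [h, Finset.sum_empty]; omega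
    · have hU' := Finset.mem_filter.1 hU
      have hWU := (hrel U hU'.1).resolve_left hU'.2
      -- At most one element is dropped, because anything orthogonal to `U` is orthogonal to `W <
      -- U`; the smaller rank of `W` then raises the potential.
      have hs : (A.filter fun U => ¬ M.orth U W) = {U} := by
        refine Finset.eq_singleton_iff_unique_mem.2 ⟨hU, fun V hV => ?_⟩
        by_contra hVU
        have hV' := Finset.mem_filter.1 hV
        exact hV'.2 (M.orth_symm _ _ (M.orth_of_nested _ _ _ hWU.le
          (hA.pairwise hU'.1 hV'.1 (Ne.symm hVU))))
      rw [hs, Finset.sum_singleton]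
      have := M.rk_lt W U hWU
      have := M.rk_le U
      omega

/-- Consistent tuples are coarsely realized by points of `X`. -/
theorem exists_realization (M : PointModel X S C) (κ : ℝ) : ∃ θ : ℝ, ∀ b : (W : S) → C W,
    M.Consistent κ b → ∃ z, ∀ W, dist (M.P W z) (b W) ≤ θ := by
  obtain ⟨T, hT⟩ := M.finite_setOf_le_dist
  -- `m` bounds the corrections still possible. Recursion on it fixes the final constant before `b`
  -- and `A` are given.
  have key : ∀ (m : ℕ) (c : ℝ), ∃ θ : ℝ, ∀ (b : (W : S) → C W) (A : Finset S),
      M.Consistent (max κ M.k) b → M.Valid c b A →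
      (M.n + 1) * (M.n + 1) < M.potential A + m → ∃ z, ∀ W, dist (M.P W z) (b W) ≤ θ := by
    intro m
    induction m with
    | zero =>
      intro c
      exact ⟨0, fun b A _ hA h => absurd hA.potential_le (by omega)⟩
    | succ m ih =>
      intro c
      obtain ⟨θ, hθ⟩ := Valid.realize_or_extend (le_max_right κ M.k) hT c
      obtain ⟨θ', hθ'⟩ := ih θ
      refine ⟨max θ θ', fun b A hb hA h => ?_⟩
      rcases hθ b A hb hA with ⟨z, hz⟩ | ⟨A', hA', hlt⟩
      · exact ⟨z, fun W => (hz W).trans (le_max_left _ _)⟩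
      · obtain ⟨z, hz⟩ := hθ' b A' hb hA' (by omega)
        exact ⟨z, fun W => (hz W).trans (le_max_right _ _)⟩
  obtain ⟨θ, hθ⟩ := key ((M.n + 1) * (M.n + 1) + 1) 0
  refine ⟨θ, fun b hb => hθ b ∅ ?_ ⟨by simp, by simp⟩ (by simp [potential])⟩
  have h := le_max_left κ M.k
  exact ⟨fun V W hVW => (hb.transverse V W hVW).imp h.trans' h.trans',
    fun V W hVW => (hb.nested V W hVW).imp h.trans' h.trans',
    fun W => (hb.near W).imp fun _ => h.trans', hb.between⟩

end PointModel

/-! ### Running maxima of positions and monotone paths. -/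

namespace PointModel

variable {X : Type*} [MetricSpace X] {S : Type*} [PartialOrder S]
    {C : S → Type*} [∀ W, MetricSpace (C W)] (M : PointModel X S C)

/-- The number `s W` is, for every `W`, the largest position of points of `Z` along the geodesic
from `x` to `y` in `C W`. -/
def IsMaxPosition (x y : X) (Z : Set X) (s : S → ℝ) : Prop :=
  ∀ W, (∀ z ∈ Z, gprod (M.P W x) (M.P W y) (M.P W z) ≤ s W) ∧
    ∃ z ∈ Z, gprod (M.P W x) (M.P W y) (M.P W z) = s W

variable {M} {x y : X} {Z : Set X} {s : S → ℝ} {c : (W : S) → ℝ → C W}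

theorem IsMaxPosition.nonneg (hs : M.IsMaxPosition x y Z s) (W : S) : 0 ≤ s W := by
  obtain ⟨z, -, hz⟩ := (hs W).2
  exact hz ▸ gprod_nonneg _ _ _

theorem IsMaxPosition.le (hs : M.IsMaxPosition x y Z s) (W : S) :
    s W ≤ dist (M.P W x) (M.P W y) := by
  obtain ⟨z, -, hz⟩ := (hs W).2
  exact hz ▸ gprod_le _ _ _

/-- A point `z` realizing the maximum in `V` is far from `x`, hence from `R W V`. By consistency it
is near `R V W`, so near `y` in `W`, which pushes `s W` close to the end. -/
theorem IsMaxPosition.transverse_aux (hs : M.IsMaxPosition x y Z s)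
    (hc : ∀ W, IsGeodesicCurve (M.P W x) (M.P W y) (c W)) {V W : S}
    (h : Transverse M.orth V W) (hV : 6 * M.k < dist (c V (s V)) (M.R W V))
    (hx : dist (M.P V x) (M.R W V) ≤ M.k) (hy : dist (M.P W y) (M.R V W) ≤ M.k) :
    dist (c W (s W)) (M.R V W) ≤ 6 * M.k := by
  have hk := M.one_le_k
  obtain ⟨z, hz, hzs⟩ := (hs V).2
  have h1 := (hc V).dist_left (hs.nonneg V) (hs.le V)
  have h2 := dist_triangle_left (c V (s V)) (M.R W V) (M.P V x)
  have h3 := gprod_le_dist (M.P V x) (M.P V y) (M.P V z)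
  have h4 := dist_triangle_right (M.P V x) (M.P V z) (M.R W V)
  rcases M.consistency_transverse V W h z with h5 | h5
  · have h6 := dist_triangle_right (M.P W z) (M.P W y) (M.R V W)
    have h7 := dist_sub_gprod_le (M.P W x) (M.P W y) (M.P W z)
    have h8 := (hs W).1 z hz
    have h9 := (hc W).dist_right (hs.nonneg W) (hs.le W)
    have h10 := dist_triangle (c W (s W)) (M.P W y) (M.R V W)
    linarith
  · linarith

theorem IsMaxPosition.consistent (hs : M.IsMaxPosition x y Z s)
    (hc : ∀ W, IsGeodesicCurve (M.P W x) (M.P W y) (c W)) :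
    M.Consistent (6 * M.k) fun W => c W (s W) := by
  have hk := M.one_le_k
  have hleft : ∀ W, dist (M.P W x) (c W (s W)) = s W := fun W =>
    (hc W).dist_left (hs.nonneg W) (hs.le W)
  have hright : ∀ W, dist (c W (s W)) (M.P W y) = dist (M.P W x) (M.P W y) - s W := fun W =>
    (hc W).dist_right (hs.nonneg W) (hs.le W)
  refine ⟨?_, ?_, ?_, x, y, fun W => (hleft W).le.trans (hs.le W)⟩
  · intro V W h
    have hboth : ∀ {U : S} (r : C U), dist (M.P U x) r ≤ M.k → dist (M.P U y) r ≤ M.k →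
        dist (c U (s U)) r ≤ 6 * M.k := fun {U} r h1 h2 => by
      have h3 := dist_triangle_left (c U (s U)) r (M.P U x)
      have h4 := dist_triangle_right (M.P U x) (M.P U y) r
      have h5 := hleft U
      have h6 := hs.le U
      linarith
    by_contra hcon
    rw [not_or, not_le, not_le] at hcon
    rcases M.consistency_transverse V W h x with h1 | h1 <;>
    rcases M.consistency_transverse V W h y with h2 | h2
    · exact hcon.1.not_ge (hboth _ h1 h2)
    · exact hcon.2.not_ge (hs.transverse_aux hc (h.symm M.orth_symm) hcon.1 h1 h2)
    · exact hcon.1.not_ge (hs.transverse_aux hc h hcon.2 h1 h2)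
    · exact hcon.2.not_ge (hboth _ h1 h2)
  · intro V W h
    refine or_iff_not_imp_left.2 fun hfar => ?_
    rw [not_le] at hfar
    set r := M.R V W with hr
    have hcon : ∀ z, M.k < dist (M.P W z) r →
        dist (M.P V z) (M.F W V (M.P W z)) ≤ M.k := fun z hz =>
      (M.consistency_nested V W h z).resolve_left hz.not_ge
    have hgeo : ∀ p q σ, IsGeodesicSegment p q σ → (∀ a ∈ σ, M.k < dist a r) →
        dist (M.F W V p) (M.F W V q) ≤ M.k := fun p q σ hσ hfar =>
      (M.bounded_geodesic_image V W h p q σ hσ).resolve_right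
        fun ⟨a, ha, ha'⟩ => (hfar a ha).not_ge ha'
    have hsegl := (hc W).segment le_rfl (hs.nonneg W) (hs.le W)
    have hsegr := (hc W).segment (hs.nonneg W) (hs.le W) le_rfl
    rw [(hc W).2.1] at hsegl
    rw [(hc W).2.2] at hsegr
    -- Does the geodesic in `W` pass near `r`? If so, `s W` is well beyond or well before that
    -- passage.
    by_cases hnear : ∃ s₀ ∈ Icc 0 (dist (M.P W x) (M.P W y)), dist (c W s₀) r ≤ M.k
    · obtain ⟨s₀, hs₀, hr₀⟩ := hnear
      have h1 := abs_le.1 ((abs_gprod_sub_le (M.P W x) (M.P W y) (c W s₀) r).trans hr₀)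
      rw [(hc W).gprod_eq hs₀.1 hs₀.2] at h1
      have h2 := dist_triangle (c W (s W)) (c W s₀) r
      rw [(hc W).1 _ ⟨hs.nonneg W, hs.le W⟩ _ hs₀] at h2
      have h3 : 5 * M.k < |s W - s₀| := by linarith
      have hdist := fun a => abs_le.1 (abs_gprod_sub_le (M.P W x) (M.P W y) a r)
      rcases lt_abs.1 h3 with h3 | h3
      · have hge : ∀ a, s W ≤ gprod (M.P W x) (M.P W y) a → M.k < dist a r := fun a ha => by
          linarith [(hdist a).2, h1.1]
        -- Beyond: take `z` maximal in `W`. Geodesics from `z` and from `c W (s W)` to `y` avoid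
        -- `r`, so in `V` everything is near `y`.
        obtain ⟨z, hz, hzs⟩ := (hs W).2
        obtain ⟨σ, hσ⟩ := M.geodesic W (M.P W z) (M.P W y)
        have hσ' : ∀ a ∈ σ, M.k < dist a r := fun a ha => hge a (hzs ▸ hσ.gprod_ge ha)
        have e1 := hcon z (hσ' _ hσ.left_mem)
        have e2 := hcon y (hσ' _ hσ.right_mem)
        have e3 := hgeo _ _ σ hσ hσ'
        have e4 := hgeo _ _ _ hsegr fun a ⟨u, hu, hua⟩ => hge a (by
          rw [← hua, (hc W).gprod_eq ((hs.nonneg W).trans hu.1) hu.2]; exact hu.1)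
        have e5 := dist_triangle4 (M.P V z) (M.F W V (M.P W z)) (M.F W V (M.P W y)) (M.P V y)
        have e6 := dist_triangle4 (c V (s V)) (M.P V y) (M.F W V (M.P W y))
          (M.F W V (c W (s W)))
        have e7 := dist_sub_gprod_le (M.P V x) (M.P V y) (M.P V z)
        have e8 := (hs V).1 z hz
        have e9 := hright V
        rw [dist_comm (M.F W V (M.P W y)) (M.P V y)] at e5
        rw [dist_comm (M.F W V (M.P W y))] at e6
        linarith
      · have hle : ∀ a, gprod (M.P W x) (M.P W y) a ≤ s W → M.k < dist a r := fun a ha => by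
          linarith [(hdist a).1, h1.2]
        -- Before: take `z` maximal in `V`. Its position in `W` is at most `s W`, so geodesics from
        -- `x` avoid `r` and in `V` everything is near `x`.
        obtain ⟨z, hz, hzs⟩ := (hs V).2
        obtain ⟨σ, hσ⟩ := M.geodesic W (M.P W x) (M.P W z)
        have hσ' : ∀ a ∈ σ, M.k < dist a r := fun a ha =>
          hle a ((hσ.gprod_le ha).trans ((hs W).1 z hz))
        have e1 := hcon x (hσ' _ hσ.left_mem)
        have e2 := hcon z (hσ' _ hσ.right_mem)
        have e3 := hgeo _ _ σ hσ hσ'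
        have e4 := hgeo _ _ _ hsegl fun a ⟨u, hu, hua⟩ => hle a (by
          rw [← hua, (hc W).gprod_eq hu.1 (hu.2.trans (hs.le W))]; exact hu.2)
        have e5 := dist_triangle4 (M.P V x) (M.F W V (M.P W x)) (M.F W V (M.P W z)) (M.P V z)
        have e6 := dist_triangle4 (c V (s V)) (M.P V x) (M.F W V (M.P W x))
          (M.F W V (c W (s W)))
        have e7 := gprod_le_dist (M.P V x) (M.P V y) (M.P V z)
        have e8 := hleft V
        rw [dist_comm (M.F W V (M.P W z)) (M.P V z)] at e5
        rw [dist_comm (c V (s V)) (M.P V x)] at e6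
        linarith
    · push Not at hnear
      have hx := hnear 0 ⟨le_rfl, dist_nonneg⟩
      have hy := hnear _ ⟨dist_nonneg, le_rfl⟩
      rw [(hc W).2.1] at hx
      rw [(hc W).2.2] at hy
      have e1 := hcon x hx
      have e2 := hcon y hy
      have e3 := hgeo _ _ _ hsegl fun a ⟨u, hu, hua⟩ =>
        hua ▸ hnear u ⟨hu.1, hu.2.trans (hs.le W)⟩
      have e4 := hgeo _ _ _ hsegr fun a ⟨u, hu, hua⟩ =>
        hua ▸ hnear u ⟨(hs.nonneg W).trans hu.1, hu.2⟩
      have e5 := dist_triangle4 (M.P V x) (M.F W V (M.P W x)) (M.F W V (M.P W y)) (M.P V y)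
      have e6 := dist_triangle (M.F W V (M.P W x)) (M.F W V (c W (s W))) (M.F W V (M.P W y))
      have e7 := dist_triangle4 (c V (s V)) (M.P V x) (M.F W V (M.P W x))
        (M.F W V (c W (s W)))
      have e8 := hleft V
      have e9 := hs.le V
      rw [dist_comm (M.F W V (M.P W y)) (M.P V y)] at e5
      rw [dist_comm (c V (s V)) (M.P V x)] at e7
      linarith
  · intro W
    have hseg := (hc W).segment le_rfl dist_nonneg le_rfl
    rw [(hc W).2.1, (hc W).2.2] at hseg
    obtain ⟨z, hz⟩ := M.quasiconvex W x y _ hseg (c W (s W)) ⟨s W, ⟨hs.nonneg W, hs.le W⟩, rfl⟩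
    exact ⟨z, by linarith⟩

theorem abs_partialSups_succ_sub_le {f : ℕ → ℝ} {J : ℝ} {i : ℕ} (h : |f (i + 1) - f i| ≤ J) :
    |partialSups f (i + 1) - partialSups f i| ≤ J := by
  have h0 : partialSups f i ≤ partialSups f (i + 1) := partialSups_monotone f (Nat.le_succ i)
  rw [abs_of_nonneg (sub_nonneg.2 h0), partialSups_add_one, sub_le_iff_le_add]
  have h1 := le_partialSups f i
  have h2 := abs_le.1 h
  have h3 := (abs_nonneg _).trans h
  exact sup_le (by linarith) (by linarith)

/-- Any two points are joined by a discrete path with steps of bounded size whose projection to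
every associated space is coarsely monotone along a geodesic. -/
theorem exists_monotone_path (M : PointModel X S C) : ∃ r Q : ℝ, 0 ≤ r ∧ 0 ≤ Q ∧ ∀ x y : X,
    ∃ (m : ℕ) (z : ℕ → X), z 0 = x ∧ z m = y ∧ (∀ i < m, dist (z i) (z (i + 1)) ≤ r) ∧
      ∀ W, ∃ s : ℕ → ℝ, Monotone s ∧ ∀ i ≤ m, ∀ j ≤ m,
        |dist (M.P W (z i)) (M.P W (z j)) - (|s i - s j|)| ≤ Q := by
  obtain ⟨θ, hθ⟩ := M.exists_realization (6 * M.k)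
  set J := M.k * (2 * M.k) + M.k with hJ
  -- Running maxima move by at most `J` and realization costs `2 * |θ|`, so no domain sees a step
  -- this large.
  obtain ⟨r, hr⟩ := M.uniqueness (J + 2 * |θ| + 1)
  have hθ0 := abs_nonneg θ
  have hθ1 := le_abs_self θ
  refine ⟨|r|, 2 * |θ|, abs_nonneg _, by linarith, fun x y => ?_⟩
  obtain ⟨m, p, hp0, hpm, hp, -⟩ := M.exists_coarse_path x y
  let t : S → ℕ → ℝ := fun W k => gprod (M.P W x) (M.P W y) (M.P W (p k))
  have hcur : ∀ W, ∃ c, IsGeodesicCurve (M.P W x) (M.P W y) c := fun W =>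
    (M.geodesic W (M.P W x) (M.P W y)).choose_spec.exists_curve
  choose c hc using hcur
  have hmax : ∀ i, M.IsMaxPosition x y (p '' Iic i) fun W => partialSups (t W) i := by
    intro i W
    constructor
    · rintro _ ⟨k, hk, rfl⟩
      exact le_partialSups_of_le (t W) hk
    · obtain ⟨k, hk, hk'⟩ := exists_partialSups_eq (t W) i
      exact ⟨p k, ⟨k, hk, rfl⟩, hk'.symm⟩
  choose w hw using fun i => hθ _ ((hmax i).consistent hc)
  have hd : ∀ W i j, dist (c W (partialSups (t W) i)) (c W (partialSups (t W) j)) =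
      |partialSups (t W) i - partialSups (t W) j| := fun W i j =>
    (hc W).1 _ ⟨(hmax i).nonneg W, (hmax i).le W⟩ _ ⟨(hmax j).nonneg W, (hmax j).le W⟩
  -- Realization is only coarse, so the endpoints are put in by hand; their positions are exactly
  -- the ends of each geodesic.
  let z : ℕ → X := fun i => if i = 0 then x else if i = m then y else w i
  have hz0 : z 0 = x := by simp [z]
  have hzm : z m = y := by
    by_cases h : m = 0
    · simp only [z, h, if_true]; rw [← hp0, ← hpm, h]
    · simp [z, h]
  have hz : ∀ W, ∀ i ≤ m, dist (M.P W (z i)) (c W (partialSups (t W) i)) ≤ |θ| := by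
    intro W i hi
    by_cases h0 : i = 0
    · subst h0
      have : partialSups (t W) 0 = 0 := by simp [t, hp0, gprod_self_left]
      rw [this, (hc W).2.1, hz0, dist_self]
      exact hθ0
    by_cases hm : i = m
    · subst hm
      have : partialSups (t W) i = dist (M.P W x) (M.P W y) := by
        refine le_antisymm ((hmax i).le W) ?_
        refine le_trans (le_of_eq ?_) (le_partialSups (t W) i)
        simp [t, hpm, gprod_self_right]
      rw [this, (hc W).2.2, hzm, dist_self]
      exact hθ0
    · simp only [z, h0, hm, if_false]
      exact (hw i W).trans hθ1
  have hclose : ∀ W, ∀ i ≤ m, ∀ j ≤ m, |dist (M.P W (z i)) (M.P W (z j)) -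
      (|partialSups (t W) i - partialSups (t W) j|)| ≤ 2 * |θ| := by
    intro W i hi j hj
    rw [← hd, ← Real.dist_eq]
    refine (dist_dist_dist_le _ _ _ _).trans ?_
    linarith [hz W i hi, hz W j hj]
  refine ⟨m, z, hz0, hzm, fun i hi => ?_, fun W => ⟨fun i => partialSups (t W) i,
    partialSups_monotone _, hclose W⟩⟩
  by_contra hcon
  obtain ⟨V, hV⟩ := hr _ _ ((le_abs_self r).trans (not_le.1 hcon).le)
  have h1 := (abs_le.1 (hclose V i hi.le (i + 1) hi)).2
  have h2 : |t V (i + 1) - t V i| ≤ J := by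
    refine (abs_gprod_sub_le _ _ _ _).trans ?_
    rw [dist_comm]
    exact M.dist_P_le (hp i) V
  have h3 := abs_partialSups_succ_sub_le h2
  rw [abs_sub_comm] at h3
  linarith

end PointModel

/-! ### Pruning and reparameterizing discrete paths. -/

/-- Skipping terms makes all steps of a sequence, except possibly the last, at least `Θ`. -/
theorem exists_prune (d : ℕ → ℕ → ℝ) {r Θ : ℝ} (hΘ : 0 ≤ Θ) (hd : ∀ i, d i i ≤ 0) (m : ℕ)
    (h : ∀ i, ∀ j < m, d i (j + 1) ≤ d i j + r) : ∃ (l : ℕ) (φ : ℕ → ℕ), StrictMono φ ∧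
      φ 0 = 0 ∧ φ l = m ∧ (∀ i < l, d (φ i) (φ (i + 1)) ≤ Θ + r) ∧
      ∀ i, i + 1 < l → Θ ≤ d (φ i) (φ (i + 1)) := by
  induction m with
  | zero => exact ⟨0, id, strictMono_id, rfl, rfl, by simp, by simp⟩
  | succ m ih =>
    obtain ⟨l, φ, hφ, h0, hl, h1, h2⟩ := ih fun i j hj => h i j (by omega)
    have ext : ∀ q ≤ l, d (φ q) (m + 1) ≤ Θ + r → (∀ i < q, Θ ≤ d (φ i) (φ (i + 1))) →
        ∃ (l : ℕ) (φ : ℕ → ℕ), StrictMono φ ∧ φ 0 = 0 ∧ φ l = m + 1 ∧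
          (∀ i < l, d (φ i) (φ (i + 1)) ≤ Θ + r) ∧
          ∀ i, i + 1 < l → Θ ≤ d (φ i) (φ (i + 1)) := by
      intro q hq hqr hqΘ
      have hφm : ∀ i ≤ q, φ i ≤ m := fun i hi => hl ▸ hφ.monotone (hi.trans hq)
      -- Keep `φ` up to `q` and jump to `m + 1`; later values only preserve strict monotonicity.
      refine ⟨q + 1, fun i => if i ≤ q then φ i else m + i - q, ?_, by simp [h0], by simp; omega,
        fun i hi => ?_, fun i hi => ?_⟩
      · refine strictMono_nat_of_lt_succ fun i => ?_
        by_cases hi : i + 1 ≤ q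
        · simp only [hi, if_true, (by omega : i ≤ q)]
          exact hφ (Nat.lt_succ_self i)
        · by_cases hi' : i ≤ q
          · simp only [hi, hi', if_true, if_false]
            have := hφm i hi'
            omega
          · simp only [hi, hi', if_false]
            omega
      · by_cases hi' : i + 1 ≤ q
        · simp only [hi', if_true, (by omega : i ≤ q)]
          exact h1 i (by omega)
        · obtain rfl : i = q := by omega
          simp only [le_refl, if_true, hi', if_false]
          rwa [(by omega : m + (i + 1) - i = m + 1)]
      · simp only [(by omega : i + 1 ≤ q), if_true, (by omega : i ≤ q)]
        exact hqΘ i (by omega)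
    by_cases hcase : ∀ i < l, Θ ≤ d (φ i) (φ (i + 1))
    · refine ext l le_rfl ?_ hcase
      have := h (φ l) m (by omega)
      have := hd (φ l)
      rw [hl] at *
      linarith
    -- Only the last step can be short; its endpoint is replaced by `m + 1`, which lengthens it by
    -- at most `r`.
    · push Not at hcase
      obtain ⟨i, hi, hlt⟩ := hcase
      obtain rfl : i + 1 = l := by
        by_contra hne
        exact (h2 i (by omega)).not_gt hlt
      refine ext i (Nat.le_succ i) ?_ fun j hj => h2 j (by omega)
      have := h (φ i) m (by omega)
      rw [hl] at hlt
      linarith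

/-- Piecewise linear interpolation. -/
theorem exists_strictMonoOn_extension {φ : ℕ → ℕ} (hφ : StrictMono φ) :
    ∃ g : ℝ → ℝ, StrictMonoOn g (Ici 0) ∧ ∀ i : ℕ, g i = φ i := by
  refine ⟨fun t => φ ⌊t⌋₊ + (t - ⌊t⌋₊) * (φ (⌊t⌋₊ + 1) - φ ⌊t⌋₊), ?_, fun i => by simp⟩
  intro s hs t ht hst
  have hpos : ∀ i, (0 : ℝ) < φ (i + 1) - φ i := fun i =>
    sub_pos.2 (Nat.cast_lt.2 (hφ (Nat.lt_succ_self i)))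
  have h1 := Nat.floor_le (mem_Ici.1 ht)
  have h2 := Nat.lt_floor_add_one s
  rcases (Nat.floor_mono hst.le).eq_or_lt with h | h
  · simp only [h]
    have := mul_lt_mul_of_pos_right (sub_lt_sub_right hst (⌊t⌋₊ : ℝ)) (hpos ⌊t⌋₊)
    linarith
  · have h3 : (φ (⌊s⌋₊ + 1) : ℝ) ≤ φ ⌊t⌋₊ := Nat.cast_le.2 (hφ.monotone h)
    have h4 := mul_nonneg (sub_nonneg.2 h1) (hpos ⌊t⌋₊).le
    have h5 := mul_lt_mul_of_pos_right (by linarith : s - ⌊s⌋₊ < 1) (hpos ⌊s⌋₊)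
    simp only
    linarith

theorem abs_floor_sub_floor_le {s t : ℝ} (hs : 0 ≤ s) (ht : 0 ≤ t) :
    |(⌊s⌋₊ : ℝ) - ⌊t⌋₊| ≤ |s - t| + 1 ∧ |s - t| ≤ |(⌊s⌋₊ : ℝ) - ⌊t⌋₊| + 1 := by
  have h1 := Nat.floor_le hs
  have h2 := Nat.lt_floor_add_one s
  have h3 := Nat.floor_le ht
  have h4 := Nat.lt_floor_add_one t
  have h5 := le_abs_self (s - t)
  have h6 := neg_abs_le (s - t)
  have h7 := le_abs_self ((⌊s⌋₊ : ℝ) - ⌊t⌋₊)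
  have h8 := neg_abs_le ((⌊s⌋₊ : ℝ) - ⌊t⌋₊)
  constructor <;> exact abs_le.2 ⟨by linarith, by linarith⟩

theorem inv_mul_sub_le {D a d : ℝ} (hD : 0 < D) (h : a ≤ D * (d + D)) : D⁻¹ * a - D ≤ d := by
  rw [sub_le_iff_le_add]
  exact (inv_mul_le_iff₀ hD).2 h

/-- A discrete quasigeodesic gives a quasigeodesic. -/
theorem isQuasigeodesic_floor {M : Type*} [MetricSpace M] {z : ℕ → M} {m : ℕ} {Q D : ℝ}
    (h₁ : ∀ i ≤ m, ∀ j ≤ m, dist (z i) (z j) ≤ Q * |(i : ℝ) - j|)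
    (h₂ : ∀ i ≤ m, ∀ j ≤ m, |(i : ℝ) - j| ≤ Q * dist (z i) (z j) + Q)
    (hQ : 0 ≤ Q) (hD : Q + 1 ≤ D) : IsQuasigeodesic D m fun t => z ⌊t⌋₊ := by
  intro s hs t ht
  have hi : ⌊s⌋₊ ≤ m := Nat.floor_le_of_le hs.2
  have hj : ⌊t⌋₊ ≤ m := Nat.floor_le_of_le ht.2
  obtain ⟨h3, h4⟩ := abs_floor_sub_floor_le hs.1 ht.1
  have h5 := h₁ _ hi _ hj
  have h6 := h₂ _ hi _ hj
  have h7 : (0 : ℝ) ≤ dist (z ⌊s⌋₊) (z ⌊t⌋₊) := dist_nonneg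
  constructor
  · refine inv_mul_sub_le (by linarith) ?_
    have := mul_le_mul_of_nonneg_right (by linarith : Q ≤ D) h7
    nlinarith
  · have h8 := mul_le_mul_of_nonneg_left h3 hQ
    have h11 := mul_le_mul_of_nonneg_right (by linarith : Q ≤ D) (abs_nonneg (s - t))
    dsimp only
    linarith

/-- A coarsely monotone discrete path is an unparameterized quasigeodesic. -/
theorem isUnparamQuasigeodesic_floor {M : Type*} [MetricSpace M] {f : ℕ → Set M} {p : ℕ → M}
    {s : ℕ → ℝ} {m : ℕ} {ξ r Q D : ℝ} (hp : ∀ i, p i ∈ f i) (hf : ∀ i, DiamLE (f i) ξ)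
    (hs : Monotone s) (hsr : ∀ i < m, s (i + 1) ≤ s i + r)
    (hps : ∀ i ≤ m, ∀ j ≤ m, |dist (p i) (p j) - (|s i - s j|)| ≤ Q)
    (hξ : 0 ≤ ξ) (hr : 0 ≤ r) (hD : 5 * (1 + r) + Q + 2 * ξ ≤ D) :
    IsUnparamQuasigeodesic D m fun t => f ⌊t⌋₊ := by
  -- Between kept indices `s` gains between 1 and `1 + r`, except that the last gain may be smaller.
  obtain ⟨l, φ, hφ, h0, hl, h1, h2⟩ := exists_prune (fun i j => s j - s i) (r := r) zero_le_one
    (fun i => by simp) m (fun i j hj => by linarith [hsr j hj])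
  obtain ⟨g, hg, hgφ⟩ := exists_strictMonoOn_extension hφ
  have hQ : 0 ≤ Q := (abs_nonneg _).trans (hps 0 (Nat.zero_le _) 0 (Nat.zero_le _))
  have hmono := hg.monotoneOn
  have hmem : ∀ t ∈ Icc (0 : ℝ) l, g t ∈ Icc (0 : ℝ) m := by
    intro t ht
    have e1 := hmono (mem_Ici.2 le_rfl) (mem_Ici.2 ht.1) ht.1
    have e2 := hmono (mem_Ici.2 ht.1) (mem_Ici.2 (ht.1.trans ht.2)) ht.2
    have e3 := hgφ 0
    rw [Nat.cast_zero, h0, Nat.cast_zero] at e3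
    rw [hgφ, hl] at e2
    exact ⟨e3 ▸ e1, e2⟩
  have hdist : ∀ i ≤ m, ∀ j ≤ m, ∀ a ∈ f i, ∀ b ∈ f j, dist a b ≤ |s i - s j| + Q + 2 * ξ := by
    intro i hi j hj a ha b hb
    have e1 := (abs_le.1 (hps i hi j hj)).2
    have e2 := hf i a ha _ (hp i)
    have e3 := hf j _ (hp j) b hb
    have e4 := dist_triangle4 a (p i) (p j) b
    linarith
  have hup : ∀ i j, i ≤ j → j ≤ l → s (φ j) - s (φ i) ≤ (1 + r) * (j - i) ∧
      (j : ℝ) - i ≤ s (φ j) - s (φ i) + 1 := by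
    intro i j hij
    have key : ∀ j, i ≤ j → (j ≤ l → s (φ j) - s (φ i) ≤ (1 + r) * (j - i)) ∧
        (j < l → (j : ℝ) - i ≤ s (φ j) - s (φ i)) := by
      intro j hij
      induction j, hij using Nat.le_induction with
      | base => simp
      | succ j hij ih =>
        push_cast
        constructor
        · intro hj
          linarith [ih.1 (by omega), h1 j (by omega)]
        · intro hj
          linarith [ih.2 (by omega), h2 j hj]
    intro hj
    refine ⟨(key j hij).1 hj, ?_⟩
    -- The possibly short last step is ignored, which accounts for the additive 1.
    rcases hij.lt_or_eq with hij' | rfl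
    · obtain ⟨j, rfl⟩ : ∃ k, j = k + 1 := ⟨j - 1, by omega⟩
      have e1 := (key j (by omega)).2 (by omega)
      have e2 := hs (hφ.monotone (Nat.le_succ j))
      push_cast
      linarith
    · simp
  have habs : ∀ i ≤ l, ∀ j ≤ l, |s (φ i) - s (φ j)| ≤ (1 + r) * |(i : ℝ) - j| ∧
      |(i : ℝ) - j| ≤ |s (φ i) - s (φ j)| + 1 := by
    intro i hi j hj
    rcases le_total i j with hij | hij
    · rw [abs_sub_comm, abs_sub_comm (i : ℝ), abs_of_nonneg (sub_nonneg.2 (hs (hφ.monotone hij))),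
        abs_of_nonneg (sub_nonneg.2 (Nat.cast_le.2 hij))]
      exact hup i j hij hj
    · rw [abs_of_nonneg (sub_nonneg.2 (hs (hφ.monotone hij))),
        abs_of_nonneg (sub_nonneg.2 (Nat.cast_le.2 hij))]
      exact hup j i hij hi
  have hpos : ∀ t ∈ Icc (0 : ℝ) l, s (φ ⌊t⌋₊) ≤ s ⌊g t⌋₊ ∧ s ⌊g t⌋₊ ≤ s (φ ⌊t⌋₊) + (1 + r) := by
    intro t ht
    have e1 := hmono (mem_Ici.2 (Nat.cast_nonneg ⌊t⌋₊)) (mem_Ici.2 ht.1) (Nat.floor_le ht.1)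
    rw [hgφ] at e1
    refine ⟨hs (Nat.le_floor e1), ?_⟩
    rcases ht.2.lt_or_eq with hlt | rfl
    · have e2 := hmono (mem_Ici.2 ht.1) (mem_Ici.2 (Nat.cast_nonneg (⌊t⌋₊ + 1)))
        (by push_cast; exact (Nat.lt_floor_add_one t).le)
      rw [hgφ] at e2
      have e3 := hs (Nat.floor_le_of_le e2)
      have e4 := h1 ⌊t⌋₊ ((Nat.floor_lt ht.1).2 hlt)
      linarith
    · rw [hgφ, Nat.floor_natCast, Nat.floor_natCast]
      linarith
  have hfl : ∀ t ∈ Icc (0 : ℝ) l, ⌊g t⌋₊ ≤ m := fun t ht => Nat.floor_le_of_le (hmem t ht).2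
  refine ⟨l, g, Nat.cast_nonneg l, hg.mono Icc_subset_Ici_self, hmem, ?_, ?_, ⟨?_, ?_⟩, ?_⟩
  · have := hgφ 0
    rwa [Nat.cast_zero, h0, Nat.cast_zero] at this
  · rw [hgφ, hl]
  · intro t _
    exact ⟨⟨_, hp _⟩, fun a ha b hb => (hf _ a ha b hb).trans (by linarith)⟩
  · intro t ht t' ht'
    have e0 := habs _ (Nat.floor_le_of_le ht.2) _ (Nat.floor_le_of_le ht'.2)
    have e1 := abs_floor_sub_floor_le ht.1 ht'.1
    have e2 := hpos t ht
    have e3 := hpos t' ht'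
    have e4 : |(s ⌊g t⌋₊ - s ⌊g t'⌋₊) - (s (φ ⌊t⌋₊) - s (φ ⌊t'⌋₊))| ≤ 1 + r :=
      abs_le.2 ⟨by linarith [e2.1, e3.2], by linarith [e2.2, e3.1]⟩
    have e5 := abs_le.1 ((abs_abs_sub_abs_le_abs_sub _ _).trans e4)
    have e6 := abs_le.1 (hps _ (hfl t ht) _ (hfl t' ht'))
    constructor
    · have e7 := dist_le_setDist (hf _) (hf _) (hp ⌊g t⌋₊) (hp ⌊g t'⌋₊)
      have e8 : D⁻¹ * |t - t'| ≤ |t - t'| :=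
        mul_le_of_le_one_left (abs_nonneg _) (inv_le_one_of_one_le₀ (by linarith))
      linarith [e0.2, e1.2, e5.1, e6.1]
    · have e7 := setDist_le_dist (hp ⌊g t⌋₊) (hp ⌊g t'⌋₊)
      have e8 := mul_le_mul_of_nonneg_left e1.1 (by linarith : 0 ≤ 1 + r)
      have e9 := mul_le_mul_of_nonneg_right (by linarith : 1 + r ≤ D) (abs_nonneg (t - t'))
      linarith [e0.1, e5.2, e6.2]
  · intro j hj a ha b hb
    obtain ⟨t, ht, hta⟩ := mem_iUnion₂.1 ha
    obtain ⟨t', ht', htb⟩ := mem_iUnion₂.1 hb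
    have hjl : j ≤ l := Nat.cast_le.1 hj
    have hcast : min ((j : ℝ) + 1) l = (min (j + 1) l : ℕ) := by push_cast; rfl
    have hbd : ∀ t ∈ Icc (g j) (g (min ((j : ℝ) + 1) l)), ⌊t⌋₊ ≤ m ∧ s (φ j) ≤ s ⌊t⌋₊ ∧
        s ⌊t⌋₊ ≤ s (φ j) + (1 + r) := by
      intro t ht
      rw [hcast, hgφ, hgφ] at ht
      have e1 : ⌊t⌋₊ ≤ φ (min (j + 1) l) := Nat.floor_le_of_le ht.2
      refine ⟨e1.trans (hl ▸ hφ.monotone (min_le_right _ _)), hs (Nat.le_floor ht.1),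
        (hs e1).trans ?_⟩
      rcases hjl.lt_or_eq with hlt | rfl
      · rw [min_eq_left hlt]
        linarith [h1 j hlt]
      · rw [min_eq_right (Nat.le_succ j)]
        linarith
    obtain ⟨e1, e2, e3⟩ := hbd t ht
    obtain ⟨e4, e5, e6⟩ := hbd t' ht'
    have e7 := hdist _ e1 _ e4 a hta b htb
    have e8 : |s ⌊t⌋₊ - s ⌊t'⌋₊| ≤ 1 + r := abs_le.2 ⟨by linarith, by linarith⟩
    linarith

/-! ### From monotone paths to quasigeodesics. -/

namespace PointModel

variable {X : Type*} [MetricSpace X] {S : Type*} [PartialOrder S]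
    {C : S → Type*} [∀ W, MetricSpace (C W)]

/-- Along a discrete path with large steps that is coarsely monotone in every associated space,
the number of steps is linearly bounded by the distance. -/
theorem exists_length_le (M : PointModel X S C) {Q : ℝ} (hQ : 0 ≤ Q) :
    ∃ Θ D : ℝ, 0 ≤ Θ ∧ 1 ≤ D ∧ ∀ (l : ℕ) (z : ℕ → X),
      (∀ i, i + 1 < l → Θ ≤ dist (z i) (z (i + 1))) →
      (∀ W, ∃ s : ℕ → ℝ, Monotone s ∧ ∀ i ≤ l, ∀ j ≤ l,
        |dist (M.P W (z i)) (M.P W (z j)) - (|s i - s j|)| ≤ Q) →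
      ∀ i j, i ≤ j → j ≤ l → (j : ℝ) - i ≤ D * dist (z i) (z j) + D := by
  classical
  obtain ⟨T, D, hT, hD, hsum⟩ := M.sum_dist_le
  -- One `Q` is lost in passing from a step to the gain of `s`, the other once in returning to
  -- `dist`, leaving `T` per step.
  obtain ⟨Θ, hΘ⟩ := M.uniqueness (2 * Q + T)
  refine ⟨max Θ 0, D + 1, le_max_right _ _, by linarith, fun l z hz hs i j hij hj => ?_⟩
  have hd : (0 : ℝ) ≤ dist (z i) (z j) := dist_nonneg
  by_cases hji : j ≤ i + 1
  · have : (j : ℝ) ≤ i + 1 := by exact_mod_cast hji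
    nlinarith
  have hstep : ∀ k, k + 1 < l → ∃ V, 2 * Q + T ≤ dist (M.P V (z k)) (M.P V (z (k + 1))) :=
    fun k hk => hΘ _ _ ((le_max_left _ _).trans (hz k hk))
  have : Nonempty S := ⟨(hstep i (by omega)).choose⟩
  choose! V hV using hstep
  -- The step ending at `j` is left out, since the last step of the path may be short.
  let A := Finset.Ico i (j - 1)
  have hA : ∀ k ∈ A, i ≤ k ∧ k < j ∧ k + 1 < l := fun k hk => by
    have := Finset.mem_Ico.1 hk
    omega
  have hone : ∀ W ∈ A.image V, (1 : ℝ) ≤ (A.filter fun k => V k = W).card := by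
    intro W hW
    obtain ⟨k, hk, hkW⟩ := Finset.mem_image.1 hW
    exact_mod_cast Finset.card_pos.2 ⟨k, Finset.mem_filter.2 ⟨hk, hkW⟩⟩
  have hlow : ∀ W ∈ A.image V, T * ((A.filter fun k => V k = W).card : ℝ) ≤
      dist (M.P W (z i)) (M.P W (z j)) := by
    intro W hW
    obtain ⟨s, hs, hsd⟩ := hs W
    have e1 : (2 * Q + T - Q) * ((A.filter fun k => V k = W).card : ℝ) ≤ s j - s i := by
      rw [← Finset.sum_Ico_sub s hij, mul_comm, ← nsmul_eq_mul]
      refine (Finset.card_nsmul_le_sum _ (fun k => s (k + 1) - s k) _ fun k hk => ?_).trans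
        (Finset.sum_le_sum_of_subset_of_nonneg (fun k hk => ?_)
          fun k _ _ => sub_nonneg.2 (hs (Nat.le_succ k)))
      · obtain ⟨hkA, rfl⟩ := Finset.mem_filter.1 hk
        have hk' := hA k hkA
        have e2 := hV k hk'.2.2
        have e3 := (abs_le.1 (hsd k (by omega) (k + 1) (by omega))).2
        rw [abs_sub_comm, abs_of_nonneg (sub_nonneg.2 (hs (Nat.le_succ k)))] at e3
        linarith
      · have hk' := hA k (Finset.mem_filter.1 hk).1
        exact Finset.mem_Ico.2 ⟨hk'.1, hk'.2.1⟩
    have e2 := (abs_le.1 (hsd i (by omega) j hj)).1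
    rw [abs_sub_comm, abs_of_nonneg (sub_nonneg.2 (hs hij))] at e2
    have e3 := hone W hW
    nlinarith
  have h1 := hsum (z i) (z j) (A.image V) fun W hW =>
    (le_mul_of_one_le_right (by linarith) (hone W hW)).trans (hlow W hW)
  have h2 : (A.card : ℝ) ≤ ∑ W ∈ A.image V, dist (M.P W (z i)) (M.P W (z j)) := by
    rw [Finset.card_eq_sum_card_image V A, Nat.cast_sum]
    exact Finset.sum_le_sum fun W hW =>
      (le_mul_of_one_le_left (Nat.cast_nonneg _) hT).trans (hlow W hW)
  have h3 : (j : ℝ) = (A.card : ℝ) + 1 + i := by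
    have : j = A.card + 1 + i := by
      rw [Nat.card_Ico]; omega
    exact_mod_cast this
  linarith

/-- Any two points are joined by a discrete quasigeodesic whose projection to every associated
space is coarsely monotone along a geodesic. -/
theorem exists_monotone_quasigeodesic (M : PointModel X S C) : ∃ r Q D : ℝ, 0 ≤ r ∧ 0 ≤ Q ∧
    1 ≤ D ∧ ∀ x y : X, ∃ (l : ℕ) (z : ℕ → X), z 0 = x ∧ z l = y ∧
      (∀ i < l, dist (z i) (z (i + 1)) ≤ r) ∧
      (∀ i j, i ≤ j → j ≤ l → (j : ℝ) - i ≤ D * dist (z i) (z j) + D) ∧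
      ∀ W, ∃ s : ℕ → ℝ, Monotone s ∧ ∀ i ≤ l, ∀ j ≤ l,
        |dist (M.P W (z i)) (M.P W (z j)) - (|s i - s j|)| ≤ Q := by
  obtain ⟨r, Q, hr, hQ, h⟩ := M.exists_monotone_path
  obtain ⟨Θ, D, hΘ, hD, h'⟩ := M.exists_length_le hQ
  refine ⟨Θ + r, Q, D, by linarith, hQ, hD, fun x y => ?_⟩
  obtain ⟨m, z, rfl, rfl, hz, hs⟩ := h x y
  obtain ⟨l, φ, hφ, h0, hl, h1, h2⟩ := exists_prune (fun i j => dist (z i) (z j)) hΘ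
    (fun i => (dist_self _).le) m fun i j hj =>
      (dist_triangle _ _ _).trans (add_le_add_right (hz j hj) _)
  have hle : ∀ i ≤ l, φ i ≤ m := fun i hi => hl ▸ hφ.monotone hi
  have hs' : ∀ W, ∃ s : ℕ → ℝ, Monotone s ∧ ∀ i ≤ l, ∀ j ≤ l,
      |dist (M.P W (z (φ i))) (M.P W (z (φ j))) - (|s i - s j|)| ≤ Q := fun W => by
    obtain ⟨s, hs, hs'⟩ := hs W
    exact ⟨s ∘ φ, hs.comp hφ.monotone, fun i hi j hj => hs' _ (hle i hi) _ (hle j hj)⟩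
  exact ⟨l, z ∘ φ, by simp [h0], by simp [hl], h1, h' l (z ∘ φ) h2 hs', hs'⟩

end PointModel

end HHS

theorem mainTheorem3 {X : Type*} [MetricSpace X] {S : Type*} [PartialOrder S]
    {C : S → Type*} [∀ W, MetricSpace (C W)] (H : HHS.HierarchicallyHyperbolic X S C) :
    ∃ D₀ : ℝ, 1 ≤ D₀ ∧ ∀ x y : X, ∃ (ℓ : ℝ) (γ : ℝ → X),
      0 ≤ ℓ ∧ γ 0 = x ∧ γ ℓ = y ∧ HHS.IsHierarchyPath H D₀ ℓ γ := by
  obtain ⟨M, hM⟩ := H.exists_pointModel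
  obtain ⟨r, Q, D, hr, hQ, hD, h⟩ := M.exists_monotone_quasigeodesic
  have hk := M.one_le_k
  have hξ := H.ξ_nonneg
  have hkr : 0 ≤ M.k * r := mul_nonneg (by linarith) hr
  -- The first bracket serves the path in `X`, the second its projections, where `s` gains at most
  -- `M.k * r + M.k + Q` per step.
  refine ⟨(r + D + 1) + (5 * (1 + (M.k * r + M.k + Q)) + Q + 2 * H.ξ), by linarith,
    fun x y => ?_⟩
  obtain ⟨l, z, rfl, rfl, hz, hlen, hs⟩ := h x y
  have hup : ∀ i j, i ≤ j → j ≤ l → dist (z i) (z j) ≤ r * ((j : ℝ) - i) := by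
    intro i j hij
    induction j, hij using Nat.le_induction with
    | base => simp
    | succ j hij ih =>
      intro hj
      have h1 := dist_triangle (z i) (z j) (z (j + 1))
      have h2 := hz j hj
      have h3 := ih (by omega)
      push_cast
      linarith
  refine ⟨l, fun t => z ⌊t⌋₊, Nat.cast_nonneg l, by simp, by simp,
    HHS.isQuasigeodesic_floor (Q := r + D) ?_ ?_ (by linarith) (by linarith), fun W => ?_⟩
  · intro i hi j hj
    have h0 := abs_nonneg ((i : ℝ) - j)
    have hDa := mul_nonneg (by linarith : 0 ≤ D) h0
    rcases le_total i j with hij | hij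
    · have h1 := hup i j hij hj
      rw [abs_sub_comm, abs_of_nonneg (sub_nonneg.2 (Nat.cast_le.2 hij))] at *
      linarith
    · have h1 := hup j i hij hi
      rw [abs_of_nonneg (sub_nonneg.2 (Nat.cast_le.2 hij))] at *
      rw [dist_comm]
      linarith
  · intro i hi j hj
    have hra : 0 ≤ r * dist (z i) (z j) := mul_nonneg hr dist_nonneg
    rcases le_total i j with hij | hij
    · have h1 := hlen i j hij hj
      rw [abs_sub_comm, abs_of_nonneg (sub_nonneg.2 (Nat.cast_le.2 hij))]
      linarith
    · have h1 := hlen j i hij hi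
      rw [abs_of_nonneg (sub_nonneg.2 (Nat.cast_le.2 hij))]
      rw [dist_comm] at h1
      linarith
  · obtain ⟨s, hs, hsd⟩ := hs W
    refine HHS.isUnparamQuasigeodesic_floor (f := fun i => H.proj W (z i))
      (p := fun i => M.P W (z i)) (s := s) (ξ := H.ξ) (r := M.k * r + M.k + Q) (Q := Q)
      (fun i => hM W _) (fun i => H.proj_diam W _) hs (fun i hi => ?_) hsd hξ (by linarith)
      (by linarith)
    have h1 := (abs_le.1 (hsd i hi.le (i + 1) hi)).1
    have h2 := M.dist_P_le (hz i hi) W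
    rw [abs_sub_comm, abs_of_nonneg (sub_nonneg.2 (hs (Nat.le_succ i)))] at h1
    linarith
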